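/- Let $\mathbb{D}=\{z\in\mathbb{C}:|z|<1\}$. Let $\mathcal{S}_H$ be the class of functions $f=h+\overline{g}$ on $\mathbb{D}$, with $h,g$ analytic in $\mathbb{D}$ and $h(0)=g(0)=0$, $h'(0)=1$, that are univalent (injective) and sense-preserving ($|h'(z)|^2-|g'(z)|^2>0$) in $\mathbb{D}$. Let $\mathcal{S}$ be the subclass with $g\equiv 0$, and let $\mathcal{S}^0_H(\mathcal{S})$ be the class of all $f=h+\overline{g}\in\mathcal{S}_H$ such that $g'(0)=0$ and $h+e^{i\theta}g\in\mathcal{S}$ for some $\theta\in\mathbb{R}$. Let $$K(z)=\frac{z-\frac12 z^2+\frac16 z^3}{(1-z)^3}+\overline{\left(\frac{\frac12 z^2+\frac16 z^3}{(1-z)^3}\right)}$$ be the harmonic Koebe function, and for $\alpha\in\mathbb{R}$ let $K_\alpha(z)=e^{-i\alpha}K(e^{i\alpha}z)$ be its rotations ($K_0=K$). **Theorem.** Every $f\in\mathcal{S}^0_H(\mathcal{S})$ satisfies $$\frac16\left[1-\left(\frac{1-r}{1+r}\right)^3\right]\le |f(z)|\le \frac16\left[\left(\frac{1+r}{1-r}\right)^3-1\right],\qquad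 r=|z|<1,$$ and $f(\mathbb{D})$ contains the disk $\{w:|w|<\frac16\}$. These bounds are sharp: for every $\alpha\in\mathbb{R}$, $K_\alpha\in\mathcal{S}^0_H(\mathcal{S})$; for every $0\le r<1$, equality holds for $f=K_\alpha$ in the lower bound at $z=-re^{-i\alpha}$ and in the upper bound at $z=re^{-i\alpha}$; and $K_\alpha(\mathbb{D})$ omits some point $w$ with $|w|=\frac16$. -/

import Mathlib

open scoped ComplexConjugate

namespace HarmonicUnivalent

/-- The open unit disk in the complex plane. -/
def unitDisk : Set ℂ := Metric.ball 0 1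

/-- `f = h + conj g` in the unit disk, with `h`, `g` analytic there and normalized by
`h 0 = g 0 = 0`, `h' 0 = 1`: a normalized harmonic function with analytic part `h` and
co-analytic part `g`. Values off the disk play no role. -/
structure IsNormalizedHarmonic (f h g : ℂ → ℂ) : Prop where
  analytic_h : AnalyticOnNhd ℂ h unitDisk
  analytic_g : AnalyticOnNhd ℂ g unitDisk
  h_zero : h 0 = 0
  g_zero : g 0 = 0
  deriv_h_zero : deriv h 0 = 1
  eq_add_conj : ∀ z ∈ unitDisk, f z = h z + conj (g z)

/-- The Jacobian of `h + conj g`. -/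
noncomputable def jacobian (h g : ℂ → ℂ) (z : ℂ) : ℝ := ‖deriv h z‖ ^ 2 - ‖deriv g z‖ ^ 2

/-- `f = h + conj g` is a normalized harmonic function that is sense-preserving (positive
Jacobian) and univalent (injective) in the unit disk: a member of the class `S_H`. -/
structure IsSensePreservingUnivalent (f h g : ℂ → ℂ) : Prop
    extends IsNormalizedHarmonic f h g where
  sense_preserving : ∀ z ∈ unitDisk, 0 < jacobian h g z
  univalent : Set.InjOn f unitDisk

/-- The class `S` of normalized univalent analytic functions: members of `S_H` with vanishing
co-analytic part. -/
def classS : Set (ℂ → ℂ) :=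
  {f | ∃ h g, IsSensePreservingUnivalent f h g ∧ ∀ z ∈ unitDisk, g z = 0}

/-- The class `S⁰_H(S)`: those `f = h + conj g` in `S_H` with vanishing `z̄`-derivative at the
origin (this derivative is `conj (g' 0)`) for which `h + e^{iθ} g` is in `S` for some real `θ`. -/
def classSH0S : Set (ℂ → ℂ) :=
  {f | ∃ h g, IsSensePreservingUnivalent f h g ∧ deriv g 0 = 0 ∧
    ∃ θ : ℝ, (fun z => h z + Complex.exp (θ * Complex.I) * g z) ∈ classS}

/-- The harmonic Koebe function. -/
noncomputable def harmonicKoebe (z : ℂ) : ℂ :=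
  (z - (1 / 2) * z ^ 2 + (1 / 6) * z ^ 3) / (1 - z) ^ 3 +
    conj (((1 / 2) * z ^ 2 + (1 / 6) * z ^ 3) / (1 - z) ^ 3)

/-- The rotation `z ↦ e^{-iα} K(e^{iα} z)` of the harmonic Koebe function `K`. -/
noncomputable def rotatedKoebe (α : ℝ) (z : ℂ) : ℂ :=
  Complex.exp (-(α * Complex.I)) * harmonicKoebe (Complex.exp (α * Complex.I) * z)

end HarmonicUnivalent

/-! Put `φ = h + e^{iθ} g ∈ S` and `r = |z|`. Since `g'(0) = 0`, Schwarz's lemma for the dilatation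
`g'/h'` gives `|g'| ≤ r |h'|`, so `|φ'|` lies between `(1 - r)|h'|` and `(1 + r)|h'|`. The
distortion theorem for `φ` then bounds the extreme stretchings of `f` (`dilation_bounds`): `|h'| -
|g'| ≥ (1 - r)²/(1 + r)⁴` and `|h'| + |g'| ≤ (1 + r)²/(1 - r)⁴`. The two growth functions are the
integrals of these bounds. The upper estimate follows by integrating along a radius. For the lower
one, the segment from `0` to `w` is lifted through `f` (`exists_preimage_of_expansion`); the lift
cannot leave the disk while `|w| < 1/6`, which also gives the covering statement.

The distortion theorem is derived from the area theorem: area theorem, square-root transform,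
Bieberbach's `|a₂| ≤ 2`, disk automorphisms, integration along radii. The area theorem avoids the
area enclosed by a curve. For `k(z) = 1/z + z B(z)` and `b = B(0)`, the image of `ρ ≤ |z| ≤ r` has
area at least `π(1/ρ² - 1/r²) + π|b|²(r² - ρ²)`. The linear map `v ↦ v - bρ² v̄` makes the
ellipse-like image of `|z| = ρ` nearly round, so the transformed area is at most `π(1/ρ + O(ρ²))²`.
The terms `1/ρ²` cancel; `ρ → 0` and then `r → 1` give `|b| ≤ 1`.

For sharpness, the Cayley variable `ζ = (1 + z)/(1 - z)` turns `K` into `Re K = Re(ζ³ - 1)/6`, `Im K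
= Im(ζ²)/4`. -/

namespace HarmonicUnivalent

open MeasureTheory Set Metric Complex Filter Topology

/-! ### The area theorem -/

/-- The real-linear map `v ↦ α v + β v̄`. -/
noncomputable def realLinear (α β : ℂ) : ℂ →L[ℝ] ℂ :=
  α • (1 : ℂ →L[ℝ] ℂ) + β • (conjCLE : ℂ →L[ℝ] ℂ)

lemma realLinear_apply (α β v : ℂ) : realLinear α β v = α * v + β * conj v := by
  simp [realLinear]

lemma det_realLinear (α β : ℂ) : (realLinear α β).det = ‖α‖ ^ 2 - ‖β‖ ^ 2 := by
  rw [ContinuousLinearMap.det, ← LinearMap.det_toMatrix basisOneI, Matrix.det_fin_two]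
  simp only [LinearMap.toMatrix_apply, coe_basisOneI, coe_basisOneI_repr,
    ContinuousLinearMap.coe_coe, realLinear_apply, Matrix.cons_val_zero, Matrix.cons_val_one,
    Matrix.cons_val_fin_one]
  rw [← normSq_eq_norm_sq, ← normSq_eq_norm_sq, normSq_apply, normSq_apply]
  simp
  ring

lemma integral_re_circleMap_eq_zero {M : ℂ → ℂ} {s : ℝ} (hs : 0 < s)
    (hM : DifferentiableOn ℂ M (closedBall 0 s)) (h0 : M 0 = 0) :
    ∫ θ in (0 : ℝ)..2 * Real.pi, (M (circleMap 0 s θ)).re = 0 := by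
  have hd : DiffContOnCl ℂ M (ball 0 |s|) := by
    apply DifferentiableOn.diffContOnCl
    rwa [abs_of_pos hs, closure_ball _ hs.ne']
  have h1 := hd.circleAverage
  rw [h0, Real.circleAverage] at h1
  have h2 : ∫ θ in (0 : ℝ)..2 * Real.pi, M (circleMap 0 s θ) = 0 := by
    rcases smul_eq_zero.1 h1 with h | h
    · exact absurd h (by have := Real.pi_pos; positivity)
    · exact h
  have hc : Continuous fun θ : ℝ => M (circleMap 0 s θ) :=
    hM.continuousOn.comp_continuous (continuous_circleMap 0 s) fun θ =>
      circleMap_mem_closedBall 0 hs.le θ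
  have h3 := (reCLM.intervalIntegral_comp_comm (μ := volume) (hc.intervalIntegrable 0 (2 * Real.pi)))
  rw [h2] at h3
  simpa using h3

/-- The integrand minorizing `‖-1/z + z (b + q)‖²`. -/
lemma minorant_le {z b q : ℂ} {s : ℝ} (hs : 0 < s) (hz : ‖z‖ = s) :
    (s ^ 2)⁻¹ + ‖b‖ ^ 2 * s ^ 2 +
      2 * (-((s ^ 2)⁻¹ : ℝ) * z ^ 2 * (b + q) + (s ^ 2 : ℝ) * conj b * q).re ≤
      ‖-1 / z + z * (b + q)‖ ^ 2 := by
  have hz0 : z ≠ 0 := by rw [← norm_pos_iff, hz]; exact hs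
  have hzz : z * conj z = (s ^ 2 : ℝ) := by rw [mul_conj, normSq_eq_norm_sq, hz]
  have hs0 : ((s ^ 2 : ℝ) : ℂ) ≠ 0 := by exact_mod_cast (pow_pos hs 2).ne'
  have h1 : -1 / z = -((s ^ 2)⁻¹ : ℝ) * conj z := by
    rw [div_eq_iff hz0, mul_assoc, mul_comm (conj z), hzz, ofReal_inv, neg_mul,
      inv_mul_cancel₀ hs0]
  rw [h1, ← normSq_eq_norm_sq, ← normSq_eq_norm_sq]
  have hsq : z.re ^ 2 + z.im ^ 2 = s ^ 2 := by
    rw [← hz, ← normSq_eq_norm_sq, normSq_apply]; ring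
  have hsp : 0 < s ^ 2 := by positivity
  set t := s ^ 2 with ht
  set τ := t⁻¹ with hτ
  have htt : t * τ = 1 := mul_inv_cancel₀ hsp.ne'
  -- This is `s²|q|²`, exactly the difference between the two sides.
  have hq : 0 ≤ t * (q.re ^ 2 + q.im ^ 2) := by positivity
  rw [← sub_nonneg]
  convert hq using 1
  simp only [normSq_apply, add_re, add_im, mul_re, mul_im, neg_re, neg_im, ofReal_re, ofReal_im,
    conj_re, conj_im, pow_two z]
  linear_combination (τ ^ 2 + (b.re + q.re) ^ 2 + (b.im + q.im) ^ 2) * hsq + τ * htt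

/-- In the coordinates `log|z|` and `arg z`, the minorant on each circle is a constant plus twice
the real part of a holomorphic function vanishing at `0`. That real part has mean zero, so only the
contributions of `1/z` and `bz` survive. -/
lemma area_lower_bound {Q : ℂ → ℂ} (hQ : DifferentiableOn ℂ Q (ball 0 1)) (hQ0 : Q 0 = 0) (b : ℂ)
    {x y : ℝ} (hxy : x ≤ y) (hy : y < 0) :
    Real.pi * (Real.exp (-2 * x) - Real.exp (-2 * y)) +
      Real.pi * ‖b‖ ^ 2 * (Real.exp (2 * y) - Real.exp (2 * x)) ≤
    ∫ p in Icc x y ×ˢ Ioc 0 (2 * Real.pi),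
      ‖-1 / circleMap 0 (Real.exp p.1) p.2 + circleMap 0 (Real.exp p.1) p.2 *
        (b + Q (circleMap 0 (Real.exp p.1) p.2))‖ ^ 2 := by
  set Z : ℝ × ℝ → ℂ := fun p => circleMap 0 (Real.exp p.1) p.2 with hZ
  have hZn : ∀ p, ‖Z p‖ = Real.exp p.1 := fun p => by simp [hZ]
  have hZ0 : ∀ p, Z p ≠ 0 := fun p => by
    rw [← norm_pos_iff, hZn]; exact Real.exp_pos _
  have hZc : Continuous Z := by
    simp only [hZ, circleMap]; fun_prop
  set M : ℝ → ℂ → ℂ := fun t z => -((Real.exp t ^ 2)⁻¹ : ℝ) * z ^ 2 * (b + Q z) +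
    (Real.exp t ^ 2 : ℝ) * conj b * Q z with hM
  set P : ℝ × ℝ → ℝ := fun p => (Real.exp p.1 ^ 2)⁻¹ + ‖b‖ ^ 2 * Real.exp p.1 ^ 2 +
      2 * (M p.1 (Z p)).re with hP
  have hmaps : MapsTo Z (Icc x y ×ˢ Icc 0 (2 * Real.pi)) (ball 0 1) := by
    rintro p ⟨hp, -⟩
    rw [mem_ball_zero_iff, hZn, Real.exp_lt_one_iff]
    exact hp.2.trans_lt hy
  have hQc : ContinuousOn (fun p => Q (Z p)) (Icc x y ×ˢ Icc 0 (2 * Real.pi)) :=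
    hQ.continuousOn.comp hZc.continuousOn hmaps
  have hcomp : IsCompact (Icc x y ×ˢ Icc 0 (2 * Real.pi)) := isCompact_Icc.prod isCompact_Icc
  have hsub : Icc x y ×ˢ Ioc 0 (2 * Real.pi) ⊆ Icc x y ×ˢ Icc 0 (2 * Real.pi) :=
    prod_mono subset_rfl Ioc_subset_Icc_self
  have hPc : ContinuousOn P (Icc x y ×ˢ Icc 0 (2 * Real.pi)) := by
    have h1 : Continuous fun p : ℝ × ℝ => (Real.exp p.1 ^ 2)⁻¹ :=
      Continuous.inv₀ (by fun_prop) fun p => by positivity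
    have h2 : Continuous fun p : ℝ × ℝ => (((Real.exp p.1 ^ 2)⁻¹ : ℝ) : ℂ) :=
      continuous_ofReal.comp h1
    have h3 : ContinuousOn (fun p => M p.1 (Z p)) (Icc x y ×ˢ Icc 0 (2 * Real.pi)) := by
      have h6 : Continuous fun p : ℝ × ℝ => ((Real.exp p.1 ^ 2 : ℝ) : ℂ) * conj b := by fun_prop
      exact ((h2.neg.mul (hZc.pow 2)).continuousOn.mul (continuousOn_const.add hQc)).add
        (h6.continuousOn.mul hQc)
    have h4 := continuous_re.comp_continuousOn h3
    have h5 : Continuous fun p : ℝ × ℝ => (Real.exp p.1 ^ 2)⁻¹ + ‖b‖ ^ 2 * Real.exp p.1 ^ 2 :=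
      h1.add (by fun_prop)
    exact h5.continuousOn.add (continuousOn_const.mul h4)
  have hPi : IntegrableOn P (Icc x y ×ˢ Ioc 0 (2 * Real.pi)) :=
    (hPc.integrableOn_compact hcomp).mono_set hsub
  have hFi : IntegrableOn (fun p => ‖-1 / Z p + Z p * (b + Q (Z p))‖ ^ 2)
      (Icc x y ×ˢ Ioc 0 (2 * Real.pi)) := by
    refine (ContinuousOn.integrableOn_compact hcomp ?_).mono_set hsub
    have h1 : Continuous fun p => -1 / Z p := continuous_const.div hZc hZ0
    exact (h1.continuousOn.add
      (hZc.continuousOn.mul (continuousOn_const.add hQc))).norm.pow 2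
  refine le_trans (le_of_eq ?_) (setIntegral_mono_on hPi hFi
    (measurableSet_Icc.prod measurableSet_Ioc) fun p _ => minorant_le (Real.exp_pos _) (hZn p))
  rw [Measure.volume_eq_prod] at hPi ⊢
  rw [setIntegral_prod _ hPi]
  have hin : ∀ t ∈ Icc x y, ∫ θ in Ioc 0 (2 * Real.pi), P (t, θ) =
      2 * Real.pi * (Real.exp (-2 * t) + ‖b‖ ^ 2 * Real.exp (2 * t)) := by
    intro t ht
    have ht1 : closedBall (0 : ℂ) (Real.exp t) ⊆ ball 0 1 :=
      closedBall_subset_ball (by rw [Real.exp_lt_one_iff]; exact ht.2.trans_lt hy)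
    have hQ' := hQ.mono ht1
    have hMd : DifferentiableOn ℂ (M t) (closedBall 0 (Real.exp t)) := by
      simp only [hM]; fun_prop
    have hM0 : M t 0 = 0 := by simp [hM, hQ0]
    have hz := integral_re_circleMap_eq_zero (Real.exp_pos t) hMd hM0
    have hc : Continuous fun θ : ℝ => (M t (circleMap 0 (Real.exp t) θ)).re :=
      continuous_re.comp <| hMd.continuousOn.comp_continuous (continuous_circleMap 0 _) fun θ =>
        circleMap_mem_closedBall 0 (Real.exp_pos t).le θ
    rw [← intervalIntegral.integral_of_le (by positivity)]
    simp only [hP, hZ]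
    rw [intervalIntegral.integral_add (by simp) ((hc.const_mul 2).intervalIntegrable _ _),
      intervalIntegral.integral_const_mul, hz, intervalIntegral.integral_const]
    have e1 : Real.exp t ^ 2 = Real.exp (2 * t) := by rw [← Real.exp_nat_mul]; norm_num
    have e2 : (Real.exp t ^ 2)⁻¹ = Real.exp (-2 * t) := by rw [e1, ← Real.exp_neg]; ring_nf
    rw [e2, e1]
    simp
  rw [setIntegral_congr_fun measurableSet_Icc hin, integral_Icc_eq_integral_Ioc,
    ← intervalIntegral.integral_of_le hxy]
  have hd : ∀ t ∈ uIcc x y, HasDerivAt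
      (fun t => Real.pi * (-Real.exp (-2 * t) + ‖b‖ ^ 2 * Real.exp (2 * t)))
      (2 * Real.pi * (Real.exp (-2 * t) + ‖b‖ ^ 2 * Real.exp (2 * t))) t := by
    intro t _
    have h1 : HasDerivAt (fun t : ℝ => Real.exp (-2 * t)) (Real.exp (-2 * t) * -2) t := by
      simpa using ((hasDerivAt_id t).const_mul (-2)).exp
    have h2 : HasDerivAt (fun t : ℝ => Real.exp (2 * t)) (Real.exp (2 * t) * 2) t := by
      simpa using ((hasDerivAt_id t).const_mul 2).exp
    exact ((h1.neg.add (h2.const_mul _)).const_mul _).congr_deriv (by ring)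
  rw [intervalIntegral.integral_eq_sub_of_hasDerivAt hd
    (Continuous.intervalIntegrable (by fun_prop) _ _)]
  ring

/-- On `|z| = ρ` one has `ρ² conj (1/z) = z`, so subtracting `bρ² v̄` cancels the term `bz` and
leaves `1/z + O(ρ²)`. An error of order `ρ` would be too large: squared against `1/ρ` it leaves a
constant. For larger `|z|` the drop from `1/ρ` to `1/s` pays for what is not cancelled. -/
lemma norm_sub_conj_le {z b E : ℂ} {s ρ C : ℝ} (hz : ‖z‖ = s) (hρ : 0 < ρ) (hρs : ρ ≤ s)
    (hs : s ≤ 1) (hC : 0 ≤ C) (hE : ‖E‖ ≤ C * s)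
    (hρC : 2 * ρ * (C * (1 + ‖b‖) + ‖b‖) ≤ 1) :
    ‖(1 / z + z * (b + E)) - b * (ρ ^ 2 : ℝ) * conj (1 / z + z * (b + E))‖ ≤
      1 / ρ + (C * (1 + ‖b‖) + ‖b‖ ^ 2) * ρ ^ 2 := by
  have hs0 : 0 < s := hρ.trans_le hρs
  have hz0 : z ≠ 0 := by rw [← norm_pos_iff, hz]; exact hs0
  have hcz0 : conj z ≠ 0 := by simpa using hz0
  have hzz : z * conj z = (s ^ 2 : ℝ) := by rw [mul_conj, normSq_eq_norm_sq, hz]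
  have e : (1 / z + z * (b + E)) - b * (ρ ^ 2 : ℝ) * conj (1 / z + z * (b + E)) =
      1 / z + b * (((s ^ 2 - ρ ^ 2 : ℝ) : ℂ) / conj z) + z * E -
        b * (ρ ^ 2 : ℝ) * conj z * (conj b + conj E) := by
    rw [ofReal_sub, ← hzz]
    simp only [map_add, map_mul, map_div₀, map_one]
    field_simp
    ring
  have n1 : ‖1 / z‖ = 1 / s := by rw [norm_div, norm_one, hz]
  have n2 : ‖b * (((s ^ 2 - ρ ^ 2 : ℝ) : ℂ) / conj z)‖ = ‖b‖ * ((s ^ 2 - ρ ^ 2) / s) := by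
    rw [norm_mul, norm_div, norm_real, norm_conj, hz, Real.norm_of_nonneg (by nlinarith)]
  have n3 : ‖z * E‖ ≤ C * s ^ 2 := by
    rw [norm_mul, hz]; nlinarith
  have n4 : ‖b * (ρ ^ 2 : ℝ) * conj z * (conj b + conj E)‖ ≤
      ‖b‖ * ρ ^ 2 * s * (‖b‖ + C * s) := by
    rw [norm_mul, norm_mul, norm_mul, norm_real, norm_conj, hz, Real.norm_of_nonneg (by positivity)]
    gcongr
    exact (norm_add_le _ _).trans (by rw [norm_conj, norm_conj]; gcongr)
  have hb := norm_nonneg b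
  set β := ‖b‖
  have n5 : β * ρ ^ 2 * s * (β + C * s) ≤ β ^ 2 * ρ ^ 2 + β * C * s ^ 2 := by
    have h1 : β ^ 2 * ρ ^ 2 * s ≤ β ^ 2 * ρ ^ 2 * 1 := by gcongr
    have h2 : β * C * s ^ 2 * ρ ^ 2 ≤ β * C * s ^ 2 * 1 := by
      gcongr; exact pow_le_one₀ hρ.le (hρs.trans hs)
    nlinarith
  -- Both sides carry the factor `s - ρ`; the smallness condition `hρC` compares what remains.
  have n6 : β * ((s ^ 2 - ρ ^ 2) / s) + C * (1 + β) * (s ^ 2 - ρ ^ 2) ≤ 1 / ρ - 1 / s := by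
    have h1 : β + C * (1 + β) * s ≤ C * (1 + β) + β := by
      have : C * (1 + β) * s ≤ C * (1 + β) * 1 := by gcongr
      linarith
    have h3 : (s + ρ) * ρ * (β + C * (1 + β) * s) ≤ 1 := by
      calc (s + ρ) * ρ * (β + C * (1 + β) * s) ≤ 2 * ρ * (C * (1 + β) + β) := by
            gcongr; linarith
        _ ≤ 1 := hρC
    have h4 : β * ((s ^ 2 - ρ ^ 2) / s) + C * (1 + β) * (s ^ 2 - ρ ^ 2) =
        (s - ρ) / (s * ρ) * ((s + ρ) * ρ * (β + C * (1 + β) * s)) := by field_simp; ring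
    have h5 : 1 / ρ - 1 / s = (s - ρ) / (s * ρ) * 1 := by field_simp
    rw [h4, h5]
    have : 0 ≤ s - ρ := by linarith
    gcongr
  rw [e]
  calc _ ≤ ‖1 / z‖ + ‖b * (((s ^ 2 - ρ ^ 2 : ℝ) : ℂ) / conj z)‖ + ‖z * E‖ +
        ‖b * (ρ ^ 2 : ℝ) * conj z * (conj b + conj E)‖ :=
        (norm_sub_le _ _).trans (add_le_add_left (norm_add₃_le) _)
    _ ≤ _ := by rw [n1, n2]; nlinarith

/-- Comparison of the area of the image of an annulus with the area of an ellipse. -/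
lemma area_comparison {B : ℂ → ℂ} (hB : DifferentiableOn ℂ B (ball 0 1))
    (hinj : InjOn (fun z => 1 / z + z * B z) (ball 0 1 \ {0})) {r ρ C : ℝ} (hr : r < 1)
    (hρ : 0 < ρ) (hρr : ρ ≤ r) (hC : 0 ≤ C) (hE : ∀ z, ‖z‖ ≤ r → ‖B z - B 0‖ ≤ C * ‖z‖)
    (hρC : 2 * ρ * (C * (1 + ‖B 0‖) + ‖B 0‖) ≤ 1) :
    (1 - ‖B 0‖ ^ 2 * ρ ^ 4) * ((1 / ρ ^ 2 - 1 / r ^ 2) + ‖B 0‖ ^ 2 * (r ^ 2 - ρ ^ 2)) ≤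
      (1 / ρ + (C * (1 + ‖B 0‖) + ‖B 0‖ ^ 2) * ρ ^ 2) ^ 2 := by
  set b := B 0
  have hr0 : 0 < r := hρ.trans_le hρr
  -- Chosen so that `-1/z + z (b + Q z)` is `z k'(z)`, the derivative of `u ↦ k (exp u)` at `z = exp
  -- u`.
  set Q : ℂ → ℂ := fun z => B z - b + z * deriv B z with hQ
  have hQd : DifferentiableOn ℂ Q (ball 0 1) :=
    (hB.sub_const b).add (differentiableOn_id.mul (hB.deriv isOpen_ball))
  have hlow := area_lower_bound hQd (by simp [hQ, b]) b (Real.log_le_log hρ hρr)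
    (Real.log_neg hr0 hr)
  set F : ℝ × ℝ → ℝ := fun p => ‖-1 / circleMap 0 (Real.exp p.1) p.2 +
    circleMap 0 (Real.exp p.1) p.2 * (b + Q (circleMap 0 (Real.exp p.1) p.2))‖ ^ 2 with hF
  set t : Set (ℝ × ℝ) := Icc (Real.log ρ) (Real.log r) ×ˢ Ioc 0 (2 * Real.pi)
  set s : Set ℂ := measurableEquivRealProd ⁻¹' t with hs
  have hts : ∫ u in s, F (measurableEquivRealProd u) = ∫ p in t, F p :=
    volume_preserving_equiv_real_prod.setIntegral_preimage_emb
      measurableEquivRealProd.measurableEmbedding F t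
  have hsm : MeasurableSet s :=
    measurableEquivRealProd.measurable (measurableSet_Icc.prod measurableSet_Ioc)
  have hmem : ∀ u ∈ s, (ρ ≤ ‖exp u‖ ∧ ‖exp u‖ ≤ r) ∧ 0 < u.im ∧ u.im ≤ 2 * Real.pi := by
    rintro u ⟨h1, h2⟩
    simp only [measurableEquivRealProd_apply] at h1 h2
    rw [norm_exp]
    exact ⟨⟨(Real.log_le_iff_le_exp hρ).1 h1.1, (Real.le_log_iff_exp_le hr0).1 h1.2⟩, h2⟩
  set k : ℂ → ℂ := fun u => 1 / exp u + exp u * B (exp u) with hk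
  set k' : ℂ → ℂ := fun u => -1 / exp u + exp u * (b + Q (exp u)) with hk'
  have hFk : ∀ u, F (measurableEquivRealProd u) = ‖k' u‖ ^ 2 := by
    intro u
    have : circleMap 0 (Real.exp u.re) u.im = exp u := by
      rw [circleMap_zero, ofReal_exp, ← exp_add, re_add_im]
    simp only [hF, hk', measurableEquivRealProd_apply, this]
  have hball : ∀ u ∈ s, exp u ∈ ball (0 : ℂ) 1 := fun u hu => by
    rw [mem_ball_zero_iff]; exact (hmem u hu).1.2.trans_lt hr
  have hkd : ∀ u ∈ s, HasDerivAt k (k' u) u := by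
    intro u hu
    have h1 : HasDerivAt B (deriv B (exp u)) (exp u) :=
      (hB.differentiableAt (isOpen_ball.mem_nhds (hball u hu))).hasDerivAt
    have h2 := h1.comp u (hasDerivAt_exp u)
    have h3 := ((hasDerivAt_exp u).inv (exp_ne_zero u)).add ((hasDerivAt_exp u).mul h2)
    refine (h3.congr_of_eventuallyEq (.of_forall fun v => by simp [hk])).congr_deriv ?_
    have := exp_ne_zero u
    simp only [hk', hQ, Function.comp]
    field_simp
    ring
  set c : ℂ := b * (ρ ^ 2 : ℝ) with hc
  have hcn : ‖c‖ ^ 2 = ‖b‖ ^ 2 * ρ ^ 4 := by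
    rw [hc, norm_mul, norm_real, Real.norm_of_nonneg (by positivity)]; ring
  have hρ1 : ρ < 1 := hρr.trans_lt hr
  have hc1 : 0 < 1 - ‖c‖ ^ 2 := by
    have h1 : ρ * ‖b‖ ≤ 1 / 2 := by
      have : 0 ≤ ρ * (C * (1 + ‖b‖)) := by positivity
      nlinarith
    have h2 : ‖c‖ ≤ 1 / 2 := by
      rw [hc, norm_mul, norm_real, Real.norm_of_nonneg (by positivity)]
      have : 0 ≤ ρ * ‖b‖ := by positivity
      nlinarith
    nlinarith [norm_nonneg c]
  set H : ℂ → ℂ := fun u => realLinear 1 (-c) (k u) with hH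
  have hHd : ∀ u ∈ s, HasFDerivWithinAt H ((realLinear 1 (-c)).comp (realLinear (k' u) 0)) s u := by
    intro u hu
    have h1 : HasFDerivAt k (realLinear (k' u) 0) u := by
      exact (hkd u hu).complexToReal_fderiv.congr_fderiv
        (ContinuousLinearMap.ext fun v => by simp [realLinear_apply])
    exact ((realLinear 1 (-c)).hasFDerivAt.comp u h1).hasFDerivWithinAt
  have hdet : ∀ u, |((realLinear 1 (-c)).comp (realLinear (k' u) 0)).det| =
      (1 - ‖c‖ ^ 2) * ‖k' u‖ ^ 2 := by
    intro u
    have : ((realLinear 1 (-c)).comp (realLinear (k' u) 0)).det =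
        (realLinear 1 (-c)).det * (realLinear (k' u) 0).det := by
      simp [ContinuousLinearMap.det]
    rw [this, det_realLinear, det_realLinear, norm_one, norm_neg, norm_zero, one_pow,
      abs_of_nonneg (mul_nonneg hc1.le (by simp))]
    ring
  have hTinj : Function.Injective (realLinear 1 (-c)) := by
    rw [injective_iff_map_eq_zero]
    intro v hv
    rw [realLinear_apply] at hv
    have h1 : v = c * conj v := by linear_combination hv
    have h2 : ‖v‖ = ‖c‖ * ‖v‖ := by
      conv_lhs => rw [h1]
      rw [norm_mul, norm_conj]
    by_contra hne
    have h3 : 0 < ‖v‖ := norm_pos_iff.2 hne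
    have h4 : ‖c‖ = 1 := by nlinarith
    rw [h4] at hc1
    norm_num at hc1
  have hHinj : InjOn H s := by
    intro u hu v hv huv
    have h1 : exp u = exp v :=
      hinj ⟨hball u hu, exp_ne_zero u⟩ ⟨hball v hv, exp_ne_zero v⟩ (hTinj huv)
    -- The shift by `πi` moves the arguments from `(0, 2π]` to `(-π, π]`, where `exp` is injective.
    have h2 : exp (u - Real.pi * I) = exp (v - Real.pi * I) := by rw [exp_sub, exp_sub, h1]
    have hu' := (hmem u hu).2
    have hv' := (hmem v hv).2
    have h3 := exp_inj_of_neg_pi_lt_of_le_pi (by simp; linarith) (by simp; linarith)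
      (by simp; linarith) (by simp; linarith) h2
    simpa using h3
  have hchange := integral_image_eq_integral_abs_det_fderiv_smul volume hsm hHd hHinj
    (fun _ => (1 : ℝ))
  have hsub : H '' s ⊆ closedBall 0 (1 / ρ + (C * (1 + ‖b‖) + ‖b‖ ^ 2) * ρ ^ 2) := by
    rintro _ ⟨u, hu, rfl⟩
    obtain ⟨⟨h1, h2⟩, -⟩ := hmem u hu
    have h3 := norm_sub_conj_le (z := exp u) (b := b) (E := B (exp u) - b) rfl hρ h1
      (h2.trans hr.le) hC (hE _ h2) hρC
    rw [mem_closedBall_zero_iff]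
    have h4 : H u = 1 / exp u + exp u * (b + (B (exp u) - b)) -
        b * (ρ ^ 2 : ℝ) * conj (1 / exp u + exp u * (b + (B (exp u) - b))) := by
      simp only [hH, realLinear_apply, hk, hc, add_sub_cancel]
      ring
    rwa [h4]
  have hvol : volume.real (H '' s) ≤ Real.pi *
      (1 / ρ + (C * (1 + ‖b‖) + ‖b‖ ^ 2) * ρ ^ 2) ^ 2 := by
    refine (measureReal_mono hsub measure_closedBall_lt_top.ne).trans_eq ?_
    rw [Measure.real, volume_closedBall]
    simp
    rw [ENNReal.toReal_ofReal (by positivity)]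
    ring
  simp only [smul_eq_mul, mul_one, integral_const, hdet, measureReal_restrict_apply_univ] at hchange
  rw [integral_const_mul] at hchange
  rw [← hts] at hlow
  simp only [hFk] at hlow
  have e1 : Real.exp (-2 * Real.log ρ) = 1 / ρ ^ 2 := by
    rw [neg_mul, Real.exp_neg, ← Real.log_rpow hρ, Real.exp_log (by positivity)]; norm_num
  have e2 : Real.exp (-2 * Real.log r) = 1 / r ^ 2 := by
    rw [neg_mul, Real.exp_neg, ← Real.log_rpow hr0, Real.exp_log (by positivity)]; norm_num
  have e3 : Real.exp (2 * Real.log ρ) = ρ ^ 2 := by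
    rw [← Real.log_rpow hρ, Real.exp_log (by positivity)]; norm_num
  have e4 : Real.exp (2 * Real.log r) = r ^ 2 := by
    rw [← Real.log_rpow hr0, Real.exp_log (by positivity)]; norm_num
  rw [e1, e2, e3, e4] at hlow
  rw [hchange] at hvol
  have h5 := (mul_le_mul_of_nonneg_left hlow hc1.le).trans hvol
  rw [← hcn]
  refine le_of_mul_le_mul_left ?_ Real.pi_pos
  refine le_trans (le_of_eq ?_) h5
  ring

/-- The area theorem (bound on the first coefficient). -/
theorem norm_coeff_le_one_of_injOn {B : ℂ → ℂ} (hB : DifferentiableOn ℂ B (ball 0 1))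
    (hinj : InjOn (fun z => 1 / z + z * B z) (ball 0 1 \ {0})) : ‖B 0‖ ≤ 1 := by
  have key : ∀ r : ℝ, 0 < r → r < 1 → ‖B 0‖ ^ 2 * r ^ 2 ≤ 1 / r ^ 2 := by
    intro r hr0 hr
    obtain ⟨C, hC, hE⟩ : ∃ C : ℝ, 0 ≤ C ∧ ∀ z, ‖z‖ ≤ r → ‖B z - B 0‖ ≤ C * ‖z‖ := by
      have h1 : DifferentiableOn ℂ (dslope B 0) (ball 0 1) :=
        (differentiableOn_dslope (ball_mem_nhds 0 one_pos)).2 hB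
      obtain ⟨C, hC⟩ := (isCompact_closedBall (0 : ℂ) r).exists_bound_of_continuousOn
        (h1.continuousOn.mono (closedBall_subset_ball hr))
      refine ⟨C, (norm_nonneg _).trans (hC 0 (by simp [hr0.le])), fun z hz => ?_⟩
      have h2 : B z - B 0 = z * dslope B 0 z := by
        simpa using (sub_smul_dslope B 0 z).symm
      rw [h2, norm_mul, mul_comm]
      gcongr
      exact hC z (by simpa using hz)
    set β := ‖B 0‖
    set D := C * (1 + β) + β ^ 2
    -- This is the difference of the two sides of `area_comparison` once `1/ρ²` has been cancelled.
    have hlim : Filter.Tendsto (fun ρ : ℝ => (-β ^ 2 * ρ ^ 2 + (1 - β ^ 2 * ρ ^ 4) *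
        (-(1 / r ^ 2) + β ^ 2 * (r ^ 2 - ρ ^ 2))) - (2 * D * ρ + D ^ 2 * ρ ^ 4))
        (nhdsWithin 0 (Ioi 0)) (nhds (-(1 / r ^ 2) + β ^ 2 * r ^ 2)) := by
      refine tendsto_nhdsWithin_of_tendsto_nhds ?_
      refine Continuous.tendsto' (by fun_prop) _ _ (by ring)
    have hle : -(1 / r ^ 2) + β ^ 2 * r ^ 2 ≤ 0 := by
      refine le_of_tendsto hlim ?_
      have hβ : 0 ≤ β := norm_nonneg _
      have hpos : 0 < min r (1 / (2 * (C * (1 + β) + β) + 1)) := lt_min hr0 (by positivity)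
      filter_upwards [Ioo_mem_nhdsGT hpos] with ρ hρ
      obtain ⟨h1, h2⟩ := lt_min_iff.1 hρ.2
      have hρ0 : 0 < ρ := hρ.1
      have h3 : 2 * ρ * (C * (1 + β) + β) ≤ 1 := by
        rw [lt_div_iff₀ (by positivity)] at h2
        nlinarith
      have h4 := area_comparison hB hinj hr hρ0 h1.le hC hE h3
      have h5 : (1 / ρ + D * ρ ^ 2) ^ 2 = 1 / ρ ^ 2 + 2 * D * ρ + D ^ 2 * ρ ^ 4 := by
        field_simp
        ring
      have h6 : (1 - β ^ 2 * ρ ^ 4) * ((1 / ρ ^ 2 - 1 / r ^ 2) + β ^ 2 * (r ^ 2 - ρ ^ 2)) =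
          1 / ρ ^ 2 + (-β ^ 2 * ρ ^ 2 + (1 - β ^ 2 * ρ ^ 4) *
            (-(1 / r ^ 2) + β ^ 2 * (r ^ 2 - ρ ^ 2))) := by
        field_simp
        ring
      rw [h5, h6] at h4
      linarith
    linarith
  have hlim : Filter.Tendsto (fun r : ℝ => ‖B 0‖ ^ 2 * r ^ 2 - 1 / r ^ 2)
      (nhdsWithin 1 (Iio 1)) (nhds (‖B 0‖ ^ 2 - 1)) := by
    refine tendsto_nhdsWithin_of_tendsto_nhds ?_
    have : ContinuousAt (fun r : ℝ => ‖B 0‖ ^ 2 * r ^ 2 - 1 / r ^ 2) 1 := by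
      fun_prop (disch := norm_num)
    simpa [ContinuousAt] using this
  have h1 : ‖B 0‖ ^ 2 - 1 ≤ 0 := by
    refine le_of_tendsto hlim ?_
    filter_upwards [Ioo_mem_nhdsLT (zero_lt_one' ℝ)] with r hr
    linarith [key r hr.1 hr.2]
  nlinarith [norm_nonneg (B 0)]

/-! ### Bieberbach's inequality and the distortion theorem -/

/-- A nonvanishing holomorphic function on the unit disk has a holomorphic inverse square root,
normalized at the origin. -/
lemma exists_inv_sqrt {χ : ℂ → ℂ} (hχ : DifferentiableOn ℂ χ (ball 0 1))
    (h0 : ∀ z ∈ ball (0 : ℂ) 1, χ z ≠ 0) :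
    ∃ ψ : ℂ → ℂ, DifferentiableOn ℂ ψ (ball 0 1) ∧ ψ 0 = 1 ∧
      deriv ψ 0 = -deriv χ 0 / (2 * χ 0) ∧ ∀ z ∈ ball (0 : ℂ) 1, ψ z ^ 2 * χ z = χ 0 := by
  have hd : DifferentiableOn ℂ (fun z => deriv χ z / χ z) (ball 0 1) :=
    (hχ.deriv isOpen_ball).div hχ h0
  -- `L` is a branch of `log (χ / χ 0)`, so `exp (-L / 2)` is the required root.
  obtain ⟨L, hL0, hL⟩ := hd.isExactOn_ball.with_val_at 0 0
  have hψ : ∀ z ∈ ball (0 : ℂ) 1, HasDerivAt (fun z => exp (-L z / 2))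
      (exp (-L z / 2) * (-(deriv χ z / χ z) / 2)) z := fun z hz =>
    ((hL z hz).neg.div_const 2).cexp
  have hm : (0 : ℂ) ∈ ball (0 : ℂ) 1 := mem_ball_self one_pos
  refine ⟨fun z => exp (-L z / 2), fun z hz => (hψ z hz).differentiableAt.differentiableWithinAt,
    by simp [hL0], ?_, ?_⟩
  · rw [(hψ 0 hm).deriv, hL0]
    have := h0 0 hm
    simp
    field_simp
  · have hc : ∀ z ∈ ball (0 : ℂ) 1, HasDerivAt (fun z => exp (-L z / 2) ^ 2 * χ z) 0 z := by
      intro z hz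
      have h1 := ((hψ z hz).pow 2).mul
        (hχ.differentiableAt (isOpen_ball.mem_nhds hz)).hasDerivAt
      refine h1.congr_deriv ?_
      have := h0 z hz
      simp
      field_simp
      ring
    intro z hz
    have := isOpen_ball.is_const_of_deriv_eq_zero (convex_ball (0 : ℂ) 1).isPreconnected
      (fun z hz => (hc z hz).differentiableAt.differentiableWithinAt)
      (fun z hz => (hc z hz).deriv) hz hm
    simpa [hL0] using this

lemma dslope_ne_zero_of_injOn {φ : ℂ → ℂ} (hinj : InjOn φ (ball 0 1)) (hd0 : deriv φ 0 ≠ 0) :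
    ∀ z ∈ ball (0 : ℂ) 1, dslope φ 0 z ≠ 0 := by
  intro z hz
  rcases eq_or_ne z 0 with rfl | hne
  · rwa [dslope_same]
  · rw [dslope_of_ne _ hne, slope_def_field]
    have h1 : φ z ≠ φ 0 := fun h => hne (hinj hz (mem_ball_self one_pos) h)
    exact div_ne_zero (sub_ne_zero.2 h1) (sub_ne_zero.2 hne)

/-- Bieberbach's bound for the second coefficient. -/
theorem norm_deriv_deriv_le {φ : ℂ → ℂ} (hφ : DifferentiableOn ℂ φ (ball 0 1))
    (hinj : InjOn φ (ball 0 1)) (hd0 : deriv φ 0 ≠ 0) :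
    ‖deriv (deriv φ) 0‖ ≤ 4 * ‖deriv φ 0‖ := by
  have hm : (0 : ℂ) ∈ ball (0 : ℂ) 1 := mem_ball_self one_pos
  have hnhds : ball (0 : ℂ) 1 ∈ nhds 0 := ball_mem_nhds 0 one_pos
  set χ := dslope φ 0 with hχdef
  have hχ : DifferentiableOn ℂ χ (ball 0 1) := (differentiableOn_dslope hnhds).2 hφ
  have hχ0 := dslope_ne_zero_of_injOn hinj hd0
  have hφχ : ∀ z, φ z = φ 0 + z * χ z := fun z => by
    have := sub_smul_dslope φ 0 z
    simp only [sub_zero, smul_eq_mul] at this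
    rw [hχdef, this]; ring
  have hderiv : deriv (deriv φ) 0 = 2 * deriv χ 0 := by
    have h1 : deriv φ =ᶠ[nhds 0] fun z => χ z + z * deriv χ z := by
      filter_upwards [hnhds] with z hz
      have h2 := ((hasDerivAt_id z).mul
        (hχ.differentiableAt (isOpen_ball.mem_nhds hz)).hasDerivAt).const_add (φ 0)
      refine ((h2.congr_of_eventuallyEq (.of_forall fun w => hφχ w)).congr_deriv ?_).deriv
      simp
    rw [h1.deriv_eq]
    have h3 : HasDerivAt χ (deriv χ 0) 0 := (hχ.differentiableAt hnhds).hasDerivAt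
    have h4 : HasDerivAt (deriv χ) (deriv (deriv χ) 0) 0 :=
      ((hχ.deriv isOpen_ball).differentiableAt hnhds).hasDerivAt
    refine ((h3.add ((hasDerivAt_id 0).mul h4)).congr_deriv ?_).deriv
    simp
    ring
  -- Square-root transform: `ψ(z²)/z` is a reciprocal square root of `(φ(z²) - φ(0))/φ'(0)`. It has
  -- the form `1/z + z β(z²)`, and `β(0) = ψ'(0)` carries the second coefficient of `φ`.
  obtain ⟨ψ, hψ, hψ0, hψ', hψsq⟩ := exists_inv_sqrt hχ hχ0
  set β := dslope ψ 0 with hβdef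
  have hβ : DifferentiableOn ℂ β (ball 0 1) := (differentiableOn_dslope hnhds).2 hψ
  have hψβ : ∀ z, ψ z = 1 + z * β z := fun z => by
    have := sub_smul_dslope ψ 0 z
    simp only [sub_zero, smul_eq_mul, hψ0] at this
    rw [hβdef, this]; ring
  have hsq : MapsTo (fun z : ℂ => z ^ 2) (ball 0 1) (ball 0 1) := fun z hz => by
    rw [mem_ball_zero_iff] at hz ⊢
    rw [norm_pow]
    exact pow_lt_one₀ (norm_nonneg _) hz two_ne_zero
  have hB : DifferentiableOn ℂ (fun z => β (z ^ 2)) (ball 0 1) :=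
    hβ.comp (by fun_prop) hsq
  have hGψ : ∀ z : ℂ, z ≠ 0 → 1 / z + z * β (z ^ 2) = ψ (z ^ 2) / z := fun z hz => by
    rw [hψβ]; field_simp
  have hG2 : ∀ z ∈ ball (0 : ℂ) 1 \ {0}, (ψ (z ^ 2) / z) ^ 2 * (φ (z ^ 2) - φ 0) = χ 0 := by
    rintro z ⟨hz, hz0 : z ≠ 0⟩
    rw [hφχ (z ^ 2), ← hψsq _ (hsq hz)]
    field_simp
    ring
  have hG0 : ∀ z ∈ ball (0 : ℂ) 1 \ {0}, ψ (z ^ 2) / z ≠ 0 := by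
    intro z hz h
    have := hG2 z hz
    rw [h] at this
    rw [zero_pow two_ne_zero, zero_mul] at this
    exact hχ0 0 hm this.symm
  have hGinj : InjOn (fun z => 1 / z + z * β (z ^ 2)) (ball 0 1 \ {0}) := by
    intro z hz w hw h
    simp only at h
    rw [hGψ z hz.2, hGψ w hw.2] at h
    have h1 := (hG2 z hz).trans (hG2 w hw).symm
    rw [h] at h1
    have h2 : φ (z ^ 2) = φ (w ^ 2) := by
      have := mul_left_cancel₀ (pow_ne_zero 2 (hG0 w hw)) h1
      linear_combination this
    have h3 : z ^ 2 = w ^ 2 := hinj (hsq hz.1) (hsq hw.1) h2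
    rcases sq_eq_sq_iff_eq_or_eq_neg.1 h3 with h4 | h4
    · exact h4
    -- The transform is odd, so equal values at `w` and `-w` would have to vanish.
    · exfalso
      have hw0 : w ≠ 0 := hw.2
      have h5 := hG0 w hw
      rw [h3, h4] at h
      have h6 : 2 * (ψ (w ^ 2) / w) = 0 := by
        rw [div_neg] at h; linear_combination -h
      exact h5 (by simpa using h6)
  have key := norm_coeff_le_one_of_injOn hB hGinj
  have h7 : χ 0 = deriv φ 0 := dslope_same φ 0
  have h8 : β (0 ^ 2) = -deriv χ 0 / (2 * χ 0) := by
    rw [← hψ', zero_pow two_ne_zero]; exact dslope_same ψ 0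
  rw [h8, norm_div, norm_neg, norm_mul, h7, Complex.norm_ofNat,
    div_le_one (by have := norm_pos_iff.2 hd0; positivity)] at key
  rw [hderiv, norm_mul, Complex.norm_ofNat]
  linarith

/-- Bieberbach's bound transported to an arbitrary point of the disk. -/
theorem norm_deriv_deriv_sub_le {φ : ℂ → ℂ} (hφ : DifferentiableOn ℂ φ (ball 0 1))
    (hinj : InjOn φ (ball 0 1)) (hd : ∀ z ∈ ball (0 : ℂ) 1, deriv φ z ≠ 0) {a : ℂ}
    (ha : a ∈ ball (0 : ℂ) 1) :
    ‖(1 - ‖a‖ ^ 2 : ℝ) * deriv (deriv φ) a - 2 * conj a * deriv φ a‖ ≤ 4 * ‖deriv φ a‖ := by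
  have ha1 : ‖a‖ < 1 := by simpa using ha
  have hm : (0 : ℂ) ∈ ball (0 : ℂ) 1 := mem_ball_self one_pos
  have hnhds : ball (0 : ℂ) 1 ∈ nhds 0 := ball_mem_nhds 0 one_pos
  have hden : ∀ z ∈ ball (0 : ℂ) 1, 1 + conj a * z ≠ 0 := by
    intro z hz h
    rw [mem_ball_zero_iff] at hz
    have h1 : ‖conj a * z‖ < 1 := by
      rw [norm_mul, norm_conj]; nlinarith [norm_nonneg a, norm_nonneg z]
    have h2 : conj a * z = -1 := by linear_combination h
    rw [h2] at h1
    norm_num at h1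
  set c : ℝ := 1 - ‖a‖ ^ 2 with hc
  have hc0 : 0 < c := by nlinarith [norm_nonneg a]
  have haa : conj a * a = 1 - (c : ℂ) := by
    rw [mul_comm, mul_conj, normSq_eq_norm_sq, hc]; push_cast; ring
  -- The disk automorphism taking `0` to `a`; Bieberbach's bound is applied to `φ ∘ m`.
  set m : ℂ → ℂ := fun z => (z + a) / (1 + conj a * z) with hmdef
  have hm0 : m 0 = a := by simp [hmdef]
  have hmaps : MapsTo m (ball 0 1) (ball 0 1) := by
    intro z hz
    have h0 := hden z hz
    rw [mem_ball_zero_iff] at hz ⊢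
    rw [hmdef, norm_div, div_lt_one (norm_pos_iff.2 h0)]
    refine lt_of_pow_lt_pow_left₀ 2 (norm_nonneg _) ?_
    rw [← normSq_eq_norm_sq, ← normSq_eq_norm_sq]
    have h1 : normSq z < 1 := by rw [normSq_eq_norm_sq]; nlinarith [norm_nonneg z]
    have h2 : normSq a < 1 := by rw [normSq_eq_norm_sq]; nlinarith [norm_nonneg a]
    have h3 : normSq (1 + conj a * z) - normSq (z + a) = (1 - normSq a) * (1 - normSq z) := by
      simp [normSq_apply]; ring
    nlinarith [mul_pos (sub_pos.2 h2) (sub_pos.2 h1)]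
  have hmd : ∀ z ∈ ball (0 : ℂ) 1, HasDerivAt m (c / (1 + conj a * z) ^ 2) z := by
    intro z hz
    have h0 := hden z hz
    have h1 := ((hasDerivAt_id z).add_const a).div
      (((hasDerivAt_id z).const_mul (conj a)).const_add 1) h0
    refine h1.congr_deriv ?_
    congr 1
    simp only [id]
    linear_combination -haa
  have hminj : InjOn m (ball 0 1) := by
    intro z hz w hw h
    simp only [hmdef] at h
    rw [div_eq_div_iff (hden z hz) (hden w hw)] at h
    have h1 : (c : ℂ) * (z - w) = 0 := by linear_combination h + (z - w) * haa
    have h2 : (c : ℂ) ≠ 0 := by exact_mod_cast hc0.ne'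
    exact sub_eq_zero.1 ((mul_eq_zero.1 h1).resolve_left h2)
  have hφd : ∀ z ∈ ball (0 : ℂ) 1, HasDerivAt φ (deriv φ z) z := fun z hz =>
    (hφ.differentiableAt (isOpen_ball.mem_nhds hz)).hasDerivAt
  have hφdd : HasDerivAt (deriv φ) (deriv (deriv φ) a) a :=
    ((hφ.deriv isOpen_ball).differentiableAt (isOpen_ball.mem_nhds ha)).hasDerivAt
  have hΦd : ∀ z ∈ ball (0 : ℂ) 1,
      HasDerivAt (φ ∘ m) (deriv φ (m z) * (c / (1 + conj a * z) ^ 2)) z := fun z hz =>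
    (hφd _ (hmaps hz)).comp z (hmd z hz)
  have h1 : deriv (φ ∘ m) 0 = c * deriv φ a := by
    rw [(hΦd 0 hm).deriv, hm0]; simp [mul_comm]
  have h2 : deriv (deriv (φ ∘ m)) 0 = c * (c * deriv (deriv φ) a - 2 * conj a * deriv φ a) := by
    have h3 : deriv (φ ∘ m) =ᶠ[nhds 0] fun z => deriv φ (m z) * (c / (1 + conj a * z) ^ 2) := by
      filter_upwards [hnhds] with z hz using (hΦd z hz).deriv
    rw [h3.deriv_eq]
    have h4 : HasDerivAt (fun z => deriv φ (m z)) (deriv (deriv φ) a * c) 0 := by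
      have h5 := hmd 0 hm
      rw [← hm0] at hφdd
      have := hφdd.comp 0 h5
      rw [hm0] at this
      simpa [Function.comp_def] using this
    have h6 : HasDerivAt (fun z : ℂ => (c : ℂ) / (1 + conj a * z) ^ 2) (-2 * conj a * c) 0 := by
      have := (hasDerivAt_const (0 : ℂ) (c : ℂ)).div
        ((((hasDerivAt_id (0 : ℂ)).const_mul (conj a)).const_add 1).pow 2) (by simp)
      refine this.congr_deriv ?_
      simp
      ring
    refine ((h4.mul h6).congr_deriv ?_).deriv
    rw [hm0]
    simp
    ring
  have hcn : (c : ℂ) ≠ 0 := by exact_mod_cast hc0.ne'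
  have key := norm_deriv_deriv_le (φ := φ ∘ m)
    (fun z hz => (hΦd z hz).differentiableAt.differentiableWithinAt)
    (hinj.comp hminj hmaps) (by rw [h1]; exact mul_ne_zero hcn (hd a ha))
  rw [h1, h2, norm_mul, norm_mul, norm_real, Real.norm_of_nonneg hc0.le] at key
  refine le_of_mul_le_mul_left ?_ hc0
  linarith

/-- The distortion theorem. -/
theorem distortion {φ : ℂ → ℂ} (hφ : DifferentiableOn ℂ φ (ball 0 1))
    (hinj : InjOn φ (ball 0 1)) (hd : ∀ z ∈ ball (0 : ℂ) 1, deriv φ z ≠ 0)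
    (hd0 : deriv φ 0 = 1) {z : ℂ} (hz : ‖z‖ < 1) :
    (1 - ‖z‖) / (1 + ‖z‖) ^ 3 ≤ ‖deriv φ z‖ ∧ ‖deriv φ z‖ ≤ (1 + ‖z‖) / (1 - ‖z‖) ^ 3 := by
  obtain ⟨e, he, hze⟩ : ∃ e : ℂ, ‖e‖ = 1 ∧ z = ‖z‖ * e := by
    refine ⟨exp (arg z * I), norm_exp_ofReal_mul_I _, (norm_mul_exp_arg_mul_I z).symm⟩
  set r := ‖z‖
  have hr0 : 0 ≤ r := norm_nonneg z
  have hmem : ∀ t ∈ Icc (0 : ℝ) r, (t : ℂ) * e ∈ ball (0 : ℂ) 1 := by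
    intro t ht
    rw [mem_ball_zero_iff, norm_mul, he, norm_real, Real.norm_of_nonneg ht.1, mul_one]
    exact ht.2.trans_lt hz
  set N : ℝ → ℝ := fun t => ‖deriv φ (t * e)‖ ^ 2 with hN
  set N' : ℝ → ℝ := fun t => 2 * (conj (deriv φ (t * e)) * (deriv (deriv φ) (t * e) * e)).re
    with hN'
  have hNd : ∀ t ∈ Icc (0 : ℝ) r, HasDerivAt N (N' t) t := by
    intro t ht
    have h1 : HasDerivAt (deriv φ) (deriv (deriv φ) (t * e)) (t * e) :=
      ((hφ.deriv isOpen_ball).differentiableAt (isOpen_ball.mem_nhds (hmem t ht))).hasDerivAt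
    have h2 : HasDerivAt (fun s : ℂ => s * e) e (t : ℂ) := by
      simpa using (hasDerivAt_id (t : ℂ)).mul_const e
    have h3 := (h1.comp (t : ℂ) h2).comp_ofReal
    have h4 := h3.norm_sq
    refine h4.congr_deriv ?_
    simp [hN', Complex.inner, mul_comm]
  -- Where `N` is positive, this says that `(log N)'` differs from `4t/(1 - t²)` by at most `8/(1 -
  -- t²)`.
  have hbd : ∀ t ∈ Icc (0 : ℝ) r, |(1 - t ^ 2) * N' t - 4 * t * N t| ≤ 8 * N t := by
    intro t ht
    have h1 := norm_deriv_deriv_sub_le hφ hinj hd (hmem t ht)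
    have hn : ‖(t : ℂ) * e‖ = t := by
      rw [norm_mul, he, norm_real, Real.norm_of_nonneg ht.1, mul_one]
    rw [hn] at h1
    have hee : e * conj e = 1 := by rw [mul_conj, normSq_eq_norm_sq, he]; simp
    set p := deriv φ (t * e)
    set q := deriv (deriv φ) (t * e)
    have hpp : conj p * p = (N t : ℂ) := by
      rw [mul_comm, mul_conj, normSq_eq_norm_sq]
    have h2 : ((1 - t ^ 2) * N' t - 4 * t * N t) =
        2 * (conj p * e * ((1 - t ^ 2 : ℝ) * q - 2 * conj (t * e) * p)).re := by
      have h3 : conj p * e * ((1 - t ^ 2 : ℝ) * q - 2 * conj (t * e) * p) =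
          ((1 - t ^ 2 : ℝ) : ℂ) * (conj p * (q * e)) - ((2 * t * N t : ℝ) : ℂ) := by
        push_cast
        rw [← hpp, map_mul, conj_ofReal]
        linear_combination (-2 * t * conj p * p) * hee
      rw [h3, sub_re, re_ofReal_mul, ofReal_re]
      simp only [hN']
      ring
    rw [h2, abs_mul, abs_two]
    have h4 := abs_re_le_norm (conj p * e * ((1 - t ^ 2 : ℝ) * q - 2 * conj (t * e) * p))
    rw [norm_mul, norm_mul, norm_conj, he, mul_one] at h4
    have h5 : ‖p‖ * ‖(1 - t ^ 2 : ℝ) * q - 2 * conj (t * e) * p‖ ≤ ‖p‖ * (4 * ‖p‖) := by gcongr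
    have h6 : N t = ‖p‖ ^ 2 := rfl
    nlinarith
  have hN0 : N 0 = 1 := by simp [hN, hd0]
  have hNr : N r = ‖deriv φ z‖ ^ 2 := by simp only [hN]; rw [← hze]
  have h0m : (0 : ℝ) ∈ Icc 0 r := ⟨le_rfl, hr0⟩
  have hrm : r ∈ Icc 0 r := ⟨hr0, le_rfl⟩
  constructor
  -- The weight is the inverse square of the extremal `(1 - t)/(1 + t)³`, an integrating factor for
  -- the lower half of `hbd`.
  · have hmono : MonotoneOn (fun t => N t * ((1 + t) ^ 6 / (1 - t) ^ 2)) (Icc 0 r) := by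
      have hder : ∀ t ∈ Icc (0 : ℝ) r, HasDerivAt (fun t => N t * ((1 + t) ^ 6 / (1 - t) ^ 2))
          ((1 + t) ^ 5 / (1 - t) ^ 3 * ((1 - t ^ 2) * N' t - 4 * t * N t + 8 * N t)) t := by
        intro t ht
        have h1 : 1 - t ≠ 0 := by linarith [ht.2]
        have h2 := (((hasDerivAt_id t).const_add 1).pow 6).div
          (((hasDerivAt_id t).const_sub 1).pow 2) (pow_ne_zero 2 h1)
        refine ((hNd t ht).mul h2).congr_deriv ?_
        simp
        field_simp
        ring
      refine monotoneOn_of_hasDerivWithinAt_nonneg (convex_Icc 0 r)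
        (fun t ht => (hder t ht).continuousAt.continuousWithinAt)
        (fun t ht => (hder t (interior_subset ht)).hasDerivWithinAt) fun t ht => ?_
      have ht := interior_subset ht
      have h1 : 0 < 1 - t := by linarith [ht.2]
      have h2 : 0 ≤ t := ht.1
      have h3 := neg_le_of_abs_le (hbd t ht)
      have h4 : 0 ≤ (1 - t ^ 2) * N' t - 4 * t * N t + 8 * N t := by linarith
      positivity
    have h1 := hmono h0m hrm hr0
    simp only [hN0, hNr] at h1
    have h2 : 0 < 1 - r := by linarith
    rw [show (1 : ℝ) * ((1 + 0) ^ 6 / (1 - 0) ^ 2) = 1 by norm_num, mul_div_assoc',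
      le_div_iff₀ (by positivity)] at h1
    rw [← pow_le_pow_iff_left₀ (by positivity) (norm_nonneg _) two_ne_zero, div_pow,
      div_le_iff₀ (by positivity)]
    linarith [h1, show ‖deriv φ z‖ ^ 2 * ((1 + r) ^ 3) ^ 2 = ‖deriv φ z‖ ^ 2 * (1 + r) ^ 6 by ring]
  -- Likewise with the extremal `(1 + t)/(1 - t)³` and the upper half of `hbd`.
  · have hanti : AntitoneOn (fun t => N t * ((1 - t) ^ 6 / (1 + t) ^ 2)) (Icc 0 r) := by
      have hder : ∀ t ∈ Icc (0 : ℝ) r, HasDerivAt (fun t => N t * ((1 - t) ^ 6 / (1 + t) ^ 2))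
          ((1 - t) ^ 5 / (1 + t) ^ 3 * ((1 - t ^ 2) * N' t - 4 * t * N t - 8 * N t)) t := by
        intro t ht
        have h1 : 1 + t ≠ 0 := by linarith [ht.1]
        have h2 := (((hasDerivAt_id t).const_sub 1).pow 6).div
          (((hasDerivAt_id t).const_add 1).pow 2) (pow_ne_zero 2 h1)
        refine ((hNd t ht).mul h2).congr_deriv ?_
        simp
        field_simp
        ring
      refine antitoneOn_of_hasDerivWithinAt_nonpos (convex_Icc 0 r)
        (fun t ht => (hder t ht).continuousAt.continuousWithinAt)
        (fun t ht => (hder t (interior_subset ht)).hasDerivWithinAt) fun t ht => ?_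
      have ht := interior_subset ht
      have h1 : 0 < 1 - t := by linarith [ht.2]
      have h2 : 0 ≤ t := ht.1
      have h3 := le_of_abs_le (hbd t ht)
      exact mul_nonpos_of_nonneg_of_nonpos (by positivity) (by linarith)
    have h1 := hanti h0m hrm hr0
    simp only [hN0, hNr] at h1
    have h2 : 0 < 1 - r := by linarith
    rw [show (1 : ℝ) * ((1 - 0) ^ 6 / (1 + 0) ^ 2) = 1 by norm_num, mul_div_assoc',
      div_le_iff₀ (by positivity)] at h1
    rw [← pow_le_pow_iff_left₀ (norm_nonneg _) (by positivity) two_ne_zero, div_pow,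
      le_div_iff₀ (by positivity)]
    linarith [h1, show ‖deriv φ z‖ ^ 2 * ((1 - r) ^ 3) ^ 2 = ‖deriv φ z‖ ^ 2 * (1 - r) ^ 6 by ring]

/-! ### The lower growth function and lifting of segments -/

/-- The lower growth function. -/
noncomputable def lowerGrowth (r : ℝ) : ℝ := (1 / 6) * (1 - ((1 - r) / (1 + r)) ^ 3)

/-- Concavity, as the tangent-line inequality. With `u = (1 - a)/(1 + a)` and `v = (1 - b)/(1 + b)`,
the gap has the factor `(u - v)²` and a positive cofactor. -/
lemma lowerGrowth_le_add {a b : ℝ} (ha : 0 ≤ a) (ha1 : a < 1) (hb : 0 ≤ b) (hb1 : b < 1) :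
    lowerGrowth b ≤ lowerGrowth a + (1 - a) ^ 2 / (1 + a) ^ 4 * (b - a) := by
  obtain ⟨u, hu⟩ : ∃ u, u = (1 - a) / (1 + a) := ⟨_, rfl⟩
  obtain ⟨v, hv⟩ : ∃ v, v = (1 - b) / (1 + b) := ⟨_, rfl⟩
  have hu0 : 0 < u := by rw [hu]; exact div_pos (by linarith) (by linarith)
  have hv0 : 0 < v := by rw [hv]; exact div_pos (by linarith) (by linarith)
  have e1 : (1 - a) ^ 2 / (1 + a) ^ 4 * (b - a) = u ^ 2 * (1 + u) * (u - v) / (2 * (1 + v)) := by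
    have h1 : 1 + u = 2 / (1 + a) := by rw [hu]; field_simp; ring
    have h2 : 1 + v = 2 / (1 + b) := by rw [hv]; field_simp; ring
    have h3 : u - v = 2 * (b - a) / ((1 + a) * (1 + b)) := by rw [hu, hv]; field_simp; ring
    rw [h1, h2, h3, hu]
    field_simp
  rw [lowerGrowth, lowerGrowth, e1, ← hu, ← hv]
  have h4 : (u ^ 3 - v ^ 3) / 6 ≤ u ^ 2 * (1 + u) * (u - v) / (2 * (1 + v)) := by
    rw [le_div_iff₀ (by positivity)]
    have : 0 ≤ (u - v) ^ 2 * ((2 * u + v) + (3 * u ^ 2 + 2 * u * v + v ^ 2)) := by positivity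
    nlinarith
  linarith

lemma lowerGrowth_lt {a b : ℝ} (ha : 0 ≤ a) (hab : a < b) (hb : b ≤ 1) :
    lowerGrowth a < lowerGrowth b := by
  have h1 : (1 - b) / (1 + b) < (1 - a) / (1 + a) := by
    rw [div_lt_div_iff₀ (by linarith) (by linarith)]; nlinarith
  have h2 : ((1 - b) / (1 + b)) ^ 3 < ((1 - a) / (1 + a)) ^ 3 :=
    pow_lt_pow_left₀ h1 (div_nonneg (by linarith) (by linarith)) three_ne_zero
  rw [lowerGrowth, lowerGrowth]
  linarith

lemma continuousOn_lowerGrowth : ContinuousOn lowerGrowth (Ici 0) := by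
  unfold lowerGrowth
  refine continuousOn_const.mul (continuousOn_const.sub (ContinuousOn.pow ?_ 3))
  exact ContinuousOn.div (by fun_prop) (by fun_prop) fun x (hx : 0 ≤ x) => by positivity

/-- Lifting of rays: an open map with a lower bound on its infinitesimal dilation covers a disk,
with control on the size of preimages. -/
lemma exists_preimage_of_expansion {f : ℂ → ℂ} (hf0 : f 0 = 0) (hc : ContinuousOn f (ball 0 1))
    (hopen : ∀ z ∈ ball (0 : ℂ) 1, map f (𝓝 z) = 𝓝 (f z)) {K : ℝ} (hK0 : 0 < K)
    (hexp : ∀ z ∈ ball (0 : ℂ) 1, ∀ᶠ z' in 𝓝 z,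
      (1 - ‖z‖) ^ 2 / (1 + ‖z‖) ^ 4 * ‖z' - z‖ ≤ K * ‖f z' - f z‖) {w : ℂ} (hw : K * ‖w‖ < 1 / 6) :
    ∃ z ∈ ball (0 : ℂ) 1, f z = w ∧ lowerGrowth ‖z‖ ≤ K * ‖w‖ := by
  set s : Set ℝ := {t | ∃ z ∈ ball (0 : ℂ) 1, f z = t * w ∧ lowerGrowth ‖z‖ ≤ K * (t * ‖w‖)}
    with hs
  -- Since `lowerGrowth 1 = 1/6`, the growth bound confines all lifted points to the compact disk of
  -- radius `ρ < 1`. Hence the set of liftable times in `[0, 1]` is closed.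
  obtain ⟨ρ, ⟨hρ0, hρ1⟩, hρ⟩ : ∃ ρ ∈ Ioo (0 : ℝ) 1, K * ‖w‖ < lowerGrowth ρ := by
    have h1 : Tendsto lowerGrowth (𝓝[<] 1) (𝓝 (lowerGrowth 1)) :=
      ((continuousOn_lowerGrowth.continuousAt (Ici_mem_nhds one_pos)).tendsto).mono_left
        nhdsWithin_le_nhds
    have h2 : K * ‖w‖ < lowerGrowth 1 := by simpa [lowerGrowth] using hw
    obtain ⟨ρ, h3, h4⟩ := ((h1.eventually (lt_mem_nhds h2)).and
      (Ioo_mem_nhdsLT (zero_lt_one' ℝ))).exists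
    exact ⟨ρ, h4, h3⟩
  have hclosed : IsClosed (s ∩ Icc 0 1) := by
    set A : Set (ℝ × ℂ) := Icc 0 1 ×ˢ closedBall 0 ρ
    have hA : IsCompact A := isCompact_Icc.prod (isCompact_closedBall 0 ρ)
    set q : ℝ × ℂ → ℂ × ℝ := fun p => (f p.2 - p.1 * w, K * (p.1 * ‖w‖) - lowerGrowth ‖p.2‖)
    have hq : ContinuousOn q A := by
      refine ContinuousOn.prodMk ?_ ?_
      · refine (hc.comp continuousOn_snd fun p hp => ?_).sub (by fun_prop)
        exact closedBall_subset_ball hρ1 hp.2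
      · refine ContinuousOn.sub (by fun_prop) ?_
        exact continuousOn_lowerGrowth.comp (by fun_prop) fun p _ => norm_nonneg _
    have hcl : IsClosed (A ∩ q ⁻¹' ({0} ×ˢ Ici 0)) :=
      hq.preimage_isClosed_of_isClosed hA.isClosed (isClosed_singleton.prod isClosed_Ici)
    have himg : s ∩ Icc 0 1 = Prod.fst '' (A ∩ q ⁻¹' ({0} ×ˢ Ici 0)) := by
      ext t
      constructor
      · rintro ⟨⟨z, hz, hfz, hL⟩, ht⟩
        refine ⟨(t, z), ⟨⟨ht, ?_⟩, ⟨sub_eq_zero.2 hfz, sub_nonneg.2 hL⟩⟩, rfl⟩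
        rw [mem_closedBall_zero_iff]
        by_contra! hlt
        have h1 := lowerGrowth_lt hρ0.le hlt (mem_ball_zero_iff.1 hz).le
        have h2 : K * (t * ‖w‖) ≤ K * (1 * ‖w‖) := by gcongr; exact ht.2
        linarith
      · rintro ⟨⟨t', z⟩, ⟨⟨ht, hz⟩, ⟨h1, h2⟩⟩, rfl⟩
        exact ⟨⟨z, closedBall_subset_ball hρ1 hz, sub_eq_zero.1 h1, sub_nonneg.1 h2⟩, ht⟩
    rw [himg]
    exact ((hA.of_isClosed_subset hcl inter_subset_left).image continuous_fst).isClosed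
  have h0s : (0 : ℝ) ∈ s := ⟨0, mem_ball_self one_pos, by simp [hf0], by simp [lowerGrowth]⟩
  -- Openness of `f` gives a nearby preimage `z'` of `t w` at which the expansion bound holds. The
  -- tangent-line inequality turns it into the growth bound at `z'`.
  have hstep : ∀ x ∈ s ∩ Ico 0 1, s ∈ 𝓝[>] x := by
    rintro x ⟨⟨z, hz, hfz, hL⟩, hx⟩
    have h1 : f '' {z' | z' ∈ ball (0 : ℂ) 1 ∧
        (1 - ‖z‖) ^ 2 / (1 + ‖z‖) ^ 4 * ‖z' - z‖ ≤ K * ‖f z' - f z‖} ∈ 𝓝 (f z) := by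
      rw [← hopen z hz]
      exact image_mem_map ((isOpen_ball.eventually_mem hz).and (hexp z hz))
    rw [hfz] at h1
    have h2 : Tendsto (fun t : ℝ => (t : ℂ) * w) (𝓝[>] x) (𝓝 (x * w)) :=
      (Continuous.tendsto (by fun_prop) x).mono_left nhdsWithin_le_nhds
    filter_upwards [h2 h1, self_mem_nhdsWithin] with t ⟨z', ⟨hz', hle⟩, hfz'⟩ (ht : x < t)
    refine ⟨z', hz', hfz', ?_⟩
    have h3 := lowerGrowth_le_add (norm_nonneg z) (mem_ball_zero_iff.1 hz) (norm_nonneg z')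
      (mem_ball_zero_iff.1 hz')
    have h4 : (1 - ‖z‖) ^ 2 / (1 + ‖z‖) ^ 4 * (‖z'‖ - ‖z‖) ≤
        (1 - ‖z‖) ^ 2 / (1 + ‖z‖) ^ 4 * ‖z' - z‖ := by
      gcongr; exact norm_sub_norm_le _ _
    have h5 : ‖f z' - f z‖ = (t - x) * ‖w‖ := by
      rw [hfz', hfz, ← sub_mul, norm_mul, ← ofReal_sub, norm_real,
        Real.norm_of_nonneg (by linarith)]
    rw [← hfz, h5] at hle
    linarith
  have := hclosed.Icc_subset_of_forall_mem_nhdsWithin h0s hstep (right_mem_Icc.2 zero_le_one)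
  simpa [hs] using this

/-! ### Local behaviour of sense-preserving harmonic maps -/

lemma norm_realLinear_ge (α β v : ℂ) : (‖α‖ - ‖β‖) * ‖v‖ ≤ ‖realLinear α β v‖ := by
  rw [realLinear_apply]
  have := norm_sub_le_norm_add (α * v) (β * conj v)
  rw [norm_mul, norm_mul, norm_conj] at this
  linarith

lemma range_realLinear {α β : ℂ} (h : ‖β‖ < ‖α‖) : (realLinear α β).range = ⊤ := by
  refine LinearMap.range_eq_top.2 (LinearMap.injective_iff_surjective.1 ?_)
  rw [injective_iff_map_eq_zero]
  intro v hv
  have h1 := norm_realLinear_ge α β v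
  have h2 : realLinear α β v = 0 := hv
  rw [h2, norm_zero] at h1
  have h3 := norm_nonneg v
  exact norm_eq_zero.1 (by nlinarith)

namespace IsSensePreservingUnivalent

variable {f h g : ℂ → ℂ}

lemma norm_deriv_lt (hf : IsSensePreservingUnivalent f h g) {z : ℂ} (hz : z ∈ ball (0 : ℂ) 1) :
    ‖deriv g z‖ < ‖deriv h z‖ := by
  have := hf.sense_preserving z hz
  rw [jacobian] at this
  exact lt_of_pow_lt_pow_left₀ 2 (norm_nonneg _) (by linarith)

lemma hasStrictFDerivAt (hf : IsSensePreservingUnivalent f h g) {z : ℂ}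
    (hz : z ∈ ball (0 : ℂ) 1) :
    HasStrictFDerivAt f (realLinear (deriv h z) (conj (deriv g z))) z := by
  have h1 := (hf.analytic_h z hz).hasStrictDerivAt.complexToReal_fderiv
  have h2 := (hf.analytic_g z hz).hasStrictDerivAt.complexToReal_fderiv
  have h3 := h1.add ((conjCLE : ℂ →L[ℝ] ℂ).hasStrictFDerivAt.comp z h2)
  have h4 : (fun z => h z + conj (g z)) =ᶠ[𝓝 z] f := by
    filter_upwards [isOpen_ball.mem_nhds hz] with w hw using (hf.eq_add_conj w hw).symm
  refine (HasStrictFDerivAt.congr_of_eventuallyEq (h3.congr_fderiv ?_) h4)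
  exact ContinuousLinearMap.ext fun v => by simp [realLinear_apply]

lemma map_zero (hf : IsSensePreservingUnivalent f h g) : f 0 = 0 := by
  rw [hf.eq_add_conj 0 (mem_ball_self one_pos), hf.h_zero, hf.g_zero]
  simp

lemma continuousOn (hf : IsSensePreservingUnivalent f h g) : ContinuousOn f (ball 0 1) :=
  fun _ hz => (hf.hasStrictFDerivAt hz).continuousAt.continuousWithinAt

lemma map_nhds (hf : IsSensePreservingUnivalent f h g) {z : ℂ} (hz : z ∈ ball (0 : ℂ) 1) :
    map f (𝓝 z) = 𝓝 (f z) :=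
  (hf.hasStrictFDerivAt hz).map_nhds_eq_of_surj
    (range_realLinear (by rw [norm_conj]; exact hf.norm_deriv_lt hz))

/-- The derivative stretches every vector by at least `|h'| - |g'|`; the slack `K > 1` absorbs the
`o(|z' - z|)` remainder. -/
lemma eventually_expansion (hf : IsSensePreservingUnivalent f h g) {z : ℂ}
    (hz : z ∈ ball (0 : ℂ) 1) {l K : ℝ} (hl0 : 0 < l) (hl : l ≤ ‖deriv h z‖ - ‖deriv g z‖)
    (hK : 1 < K) : ∀ᶠ z' in 𝓝 z, l * ‖z' - z‖ ≤ K * ‖f z' - f z‖ := by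
  have h1 := (hf.hasStrictFDerivAt hz).hasFDerivAt.isLittleO
  have hε : 0 < l * (1 - 1 / K) := mul_pos hl0 (sub_pos.2 (by rw [div_lt_one] <;> linarith))
  filter_upwards [h1.bound hε] with z' hz'
  have h2 := norm_realLinear_ge (deriv h z) (conj (deriv g z)) (z' - z)
  rw [norm_conj] at h2
  have h3 := norm_sub_norm_le (realLinear (deriv h z) (conj (deriv g z)) (z' - z)) (f z' - f z)
  rw [norm_sub_rev _ (f z' - f z)] at h3
  have h4 : l * ‖z' - z‖ ≤ (‖deriv h z‖ - ‖deriv g z‖) * ‖z' - z‖ := by gcongr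
  have hK0 : 0 < K := by linarith
  have h5 : l / K * ‖z' - z‖ ≤ ‖f z' - f z‖ := by
    have : l * (1 - 1 / K) * ‖z' - z‖ = l * ‖z' - z‖ - l / K * ‖z' - z‖ := by field_simp
    linarith
  calc l * ‖z' - z‖ = K * (l / K * ‖z' - z‖) := by field_simp
    _ ≤ _ := by gcongr

/-- Schwarz's lemma for the dilatation. -/
lemma norm_deriv_le_mul (hf : IsSensePreservingUnivalent f h g) (hg0 : deriv g 0 = 0) {z : ℂ}
    (hz : z ∈ ball (0 : ℂ) 1) : ‖deriv g z‖ ≤ ‖z‖ * ‖deriv h z‖ := by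
  have hne : ∀ w ∈ ball (0 : ℂ) 1, deriv h w ≠ 0 := fun w hw =>
    norm_pos_iff.1 ((norm_nonneg _).trans_lt (hf.norm_deriv_lt hw))
  have hd : DifferentiableOn ℂ (fun w => deriv g w / deriv h w) (ball 0 1) :=
    (hf.analytic_g.differentiableOn.deriv isOpen_ball).div
      (hf.analytic_h.differentiableOn.deriv isOpen_ball) hne
  have hmaps : MapsTo (fun w => deriv g w / deriv h w) (ball 0 1) (closedBall 0 1) := by
    intro w hw
    rw [mem_closedBall_zero_iff, norm_div,
      div_le_one (norm_pos_iff.2 (hne w hw))]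
    exact (hf.norm_deriv_lt hw).le
  have := norm_le_norm_of_mapsTo_ball hd hmaps (by simp [hg0]) (mem_ball_zero_iff.1 hz)
  rwa [norm_div, div_le_iff₀ (norm_pos_iff.2 (hne z hz))] at this

end IsSensePreservingUnivalent

/-! ### Growth and covering estimates -/

lemma distortion_of_mem_classS {φ : ℂ → ℂ} (hφ : φ ∈ classS) {z : ℂ} (hz : ‖z‖ < 1) :
    (1 - ‖z‖) / (1 + ‖z‖) ^ 3 ≤ ‖deriv φ z‖ ∧ ‖deriv φ z‖ ≤ (1 + ‖z‖) / (1 - ‖z‖) ^ 3 := by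
  obtain ⟨h, g, hf, hg⟩ := hφ
  have heq : EqOn φ h (ball 0 1) := fun w hw => by
    rw [hf.eq_add_conj w hw, hg w hw]; simp
  have hderiv : ∀ w ∈ ball (0 : ℂ) 1, deriv φ w = deriv h w := fun w hw =>
    (heq.eventuallyEq_of_mem (isOpen_ball.mem_nhds hw)).deriv_eq
  have hm : (0 : ℂ) ∈ ball (0 : ℂ) 1 := mem_ball_self one_pos
  refine distortion (hf.analytic_h.differentiableOn.congr heq) hf.univalent (fun w hw => ?_)
    (by rw [hderiv 0 hm, hf.deriv_h_zero]) hz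
  rw [hderiv w hw]
  exact norm_pos_iff.1 ((norm_nonneg _).trans_lt (hf.norm_deriv_lt hw))

lemma dilation_bounds {f h g : ℂ → ℂ} (hf : IsSensePreservingUnivalent f h g)
    (hg0 : deriv g 0 = 0) {θ : ℝ} (hS : (fun z => h z + exp (θ * I) * g z) ∈ classS) {z : ℂ}
    (hz : ‖z‖ < 1) :
    (1 - ‖z‖) ^ 2 / (1 + ‖z‖) ^ 4 ≤ ‖deriv h z‖ - ‖deriv g z‖ ∧
      ‖deriv h z‖ + ‖deriv g z‖ ≤ (1 + ‖z‖) ^ 2 / (1 - ‖z‖) ^ 4 := by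
  have hz' : z ∈ ball (0 : ℂ) 1 := mem_ball_zero_iff.2 hz
  obtain ⟨h1, h2⟩ := distortion_of_mem_classS hS hz
  have hd : deriv (fun z => h z + exp (θ * I) * g z) z = deriv h z + exp (θ * I) * deriv g z :=
    ((hf.analytic_h z hz').differentiableAt.hasDerivAt.add
      ((hf.analytic_g z hz').differentiableAt.hasDerivAt.const_mul _)).deriv
  rw [hd] at h1 h2
  have h3 := hf.norm_deriv_le_mul hg0 hz'
  have h4 : ‖exp (θ * I) * deriv g z‖ = ‖deriv g z‖ := by
    rw [norm_mul, norm_exp_ofReal_mul_I, one_mul]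
  have h5 := norm_add_le (deriv h z) (exp (θ * I) * deriv g z)
  have h6 := norm_sub_le_norm_add (deriv h z) (exp (θ * I) * deriv g z)
  rw [h4] at h5 h6
  have hr0 := norm_nonneg z
  set r := ‖z‖
  have h7 : 0 < 1 - r := by linarith
  rw [div_le_iff₀ (by positivity)] at h1
  rw [le_div_iff₀ (by positivity)] at h2
  set p := ‖deriv h z‖
  set q := ‖deriv g z‖
  constructor
  · rw [div_le_iff₀ (by positivity)]
    have h8 : 1 - r ≤ p * (1 + r) ^ 4 := by
      refine h1.trans ?_
      calc _ ≤ (p * (1 + r)) * (1 + r) ^ 3 := by gcongr; linarith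
        _ = _ := by ring
    calc (1 - r) ^ 2 = (1 - r) * (1 - r) := by ring
      _ ≤ (1 - r) * (p * (1 + r) ^ 4) := by gcongr
      _ = (p - r * p) * (1 + r) ^ 4 := by ring
      _ ≤ _ := by gcongr
  · rw [le_div_iff₀ (by positivity)]
    have h8 : p * (1 - r) ^ 4 ≤ 1 + r := by
      refine le_trans ?_ h2
      calc p * (1 - r) ^ 4 = (p * (1 - r)) * (1 - r) ^ 3 := by ring
        _ ≤ _ := by gcongr; linarith
    calc (p + q) * (1 - r) ^ 4 ≤ (p + r * p) * (1 - r) ^ 4 := by gcongr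
      _ = (1 + r) * (p * (1 - r) ^ 4) := by ring
      _ ≤ (1 + r) * (1 + r) := by gcongr
      _ = _ := by ring

lemma exists_preimage {f h g : ℂ → ℂ} (hf : IsSensePreservingUnivalent f h g)
    (hg0 : deriv g 0 = 0) {θ : ℝ} (hS : (fun z => h z + exp (θ * I) * g z) ∈ classS) {K : ℝ}
    (hK : 1 < K) {w : ℂ} (hw : K * ‖w‖ < 1 / 6) :
    ∃ z ∈ ball (0 : ℂ) 1, f z = w ∧ lowerGrowth ‖z‖ ≤ K * ‖w‖ := by
  refine exists_preimage_of_expansion hf.map_zero hf.continuousOn (fun z hz => hf.map_nhds hz)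
    (by linarith) (fun z hz => ?_) hw
  have hz1 := mem_ball_zero_iff.1 hz
  have h1 : 0 < 1 - ‖z‖ := by linarith
  exact hf.eventually_expansion hz (by positivity) (dilation_bounds hf hg0 hS hz1).1 hK

lemma eventually_mul_norm_lt {w : ℂ} (hw : ‖w‖ < 1 / 6) :
    ∀ᶠ K : ℝ in 𝓝[>] 1, 1 < K ∧ K * ‖w‖ < 1 / 6 := by
  have h1 : Tendsto (fun K : ℝ => K * ‖w‖) (𝓝[>] 1) (𝓝 ‖w‖) :=
    ((continuous_mul_const _).tendsto' _ _ (one_mul _)).mono_left nhdsWithin_le_nhds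
  filter_upwards [h1.eventually (gt_mem_nhds hw), self_mem_nhdsWithin] with K hK hK1
  exact ⟨hK1, hK⟩

theorem ball_subset_image {f : ℂ → ℂ} (hf : f ∈ classSH0S) :
    ball (0 : ℂ) (1 / 6) ⊆ f '' unitDisk := by
  obtain ⟨h, g, hf, hg0, θ, hS⟩ := hf
  intro w hw
  obtain ⟨K, hK, hKw⟩ := (eventually_mul_norm_lt (mem_ball_zero_iff.1 hw)).exists
  obtain ⟨z, hz, hfz, -⟩ := exists_preimage hf hg0 hS hK hKw
  exact ⟨z, hz, hfz⟩

/-- Below `1/6`, univalence identifies the lifted preimage of `f z` with `z`, and then `K → 1`.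
Otherwise the bound is immediate, since the growth function never exceeds `1/6`. -/
theorem lower_growth {f : ℂ → ℂ} (hf : f ∈ classSH0S) {z : ℂ} (hz : ‖z‖ < 1) :
    lowerGrowth ‖z‖ ≤ ‖f z‖ := by
  obtain ⟨h, g, hf, hg0, θ, hS⟩ := hf
  rcases lt_or_ge ‖f z‖ (1 / 6) with hlt | hge
  · have h1 : Tendsto (fun K : ℝ => K * ‖f z‖) (𝓝[>] 1) (𝓝 ‖f z‖) :=
      ((continuous_mul_const _).tendsto' _ _ (one_mul _)).mono_left nhdsWithin_le_nhds
    refine ge_of_tendsto h1 ?_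
    filter_upwards [eventually_mul_norm_lt hlt] with K ⟨hK, hKw⟩
    obtain ⟨z', hz', hfz, hL⟩ := exists_preimage hf hg0 hS hK hKw
    rwa [hf.univalent hz' (mem_ball_zero_iff.2 hz) hfz] at hL
  · refine le_trans ?_ hge
    have h1 : 0 ≤ ((1 - ‖z‖) / (1 + ‖z‖)) ^ 3 :=
      pow_nonneg (div_nonneg (by linarith) (by positivity)) 3
    rw [lowerGrowth]
    linarith

theorem upper_growth {f : ℂ → ℂ} (hf : f ∈ classSH0S) {z : ℂ} (hz : ‖z‖ < 1) :
    ‖f z‖ ≤ (1 / 6) * (((1 + ‖z‖) / (1 - ‖z‖)) ^ 3 - 1) := by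
  obtain ⟨h, g, hf, hg0, θ, hS⟩ := hf
  obtain ⟨e, he, hze⟩ : ∃ e : ℂ, ‖e‖ = 1 ∧ z = ‖z‖ * e :=
    ⟨exp (arg z * I), norm_exp_ofReal_mul_I _, (norm_mul_exp_arg_mul_I z).symm⟩
  set r := ‖z‖
  have hr0 : 0 ≤ r := norm_nonneg z
  have hn : ∀ t ∈ Icc (0 : ℝ) r, ‖(t : ℂ) * e‖ = t := fun t ht => by
    rw [norm_mul, he, norm_real, Real.norm_of_nonneg ht.1, mul_one]
  have hmem : ∀ t ∈ Icc (0 : ℝ) r, (t : ℂ) * e ∈ ball (0 : ℂ) 1 := fun t ht => by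
    rw [mem_ball_zero_iff, hn t ht]; exact ht.2.trans_lt hz
  have hFd : ∀ t ∈ Icc (0 : ℝ) r, HasDerivAt (fun t : ℝ => f (t * e))
      (realLinear (deriv h (t * e)) (conj (deriv g (t * e))) e) t := by
    intro t ht
    have h1 : HasDerivAt (fun s : ℝ => (s : ℂ) * e) e t := by
      simpa using ((hasDerivAt_id (t : ℂ)).mul_const e).comp_ofReal
    exact (hf.hasStrictFDerivAt (hmem t ht)).hasFDerivAt.comp_hasDerivAt t h1
  have hBd : ∀ t ∈ Icc (0 : ℝ) r, HasDerivAt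
      (fun t : ℝ => (1 / 6) * (((1 + t) / (1 - t)) ^ 3 - 1)) ((1 + t) ^ 2 / (1 - t) ^ 4) t := by
    intro t ht
    have h1 : 1 - t ≠ 0 := by linarith [ht.2]
    have h2 := ((((((hasDerivAt_id t).const_add 1).div ((hasDerivAt_id t).const_sub 1) h1).pow
      3).sub_const 1).const_mul (1 / 6))
    refine h2.congr_deriv ?_
    simp
    field_simp
    ring
  have key := image_norm_le_of_norm_deriv_right_le_deriv_boundary'
    (f := fun t : ℝ => f (t * e)) (a := 0) (b := r)
    (fun t ht => (hFd t ht).continuousAt.continuousWithinAt)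
    (fun t ht => (hFd t (Ico_subset_Icc_self ht)).hasDerivWithinAt)
    (by simp [hf.map_zero])
    (fun t ht => (hBd t ht).continuousAt.continuousWithinAt)
    (fun t ht => (hBd t (Ico_subset_Icc_self ht)).hasDerivWithinAt)
    (fun t ht => by
      have ht := Ico_subset_Icc_self ht
      have h1 := (dilation_bounds hf hg0 hS (mem_ball_zero_iff.1 (hmem t ht))).2
      rw [hn t ht] at h1
      refine le_trans ?_ h1
      rw [realLinear_apply]
      refine (norm_add_le _ _).trans_eq ?_
      rw [norm_mul, norm_mul, norm_conj, norm_conj, he, mul_one, mul_one])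
    (right_mem_Icc.2 hr0)
  rwa [← hze] at key

/-! ### Sharpness: the harmonic Koebe function -/

/-- The analytic part of the harmonic Koebe function. -/
noncomputable def koebeH (z : ℂ) : ℂ := (z - (1 / 2) * z ^ 2 + (1 / 6) * z ^ 3) / (1 - z) ^ 3

/-- The co-analytic part of the harmonic Koebe function. -/
noncomputable def koebeG (z : ℂ) : ℂ := ((1 / 2) * z ^ 2 + (1 / 6) * z ^ 3) / (1 - z) ^ 3

lemma one_sub_ne_zero {z : ℂ} (hz : ‖z‖ < 1) : 1 - z ≠ 0 := fun h => by
  rw [← sub_eq_zero.1 h] at hz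
  norm_num at hz

lemma hasDerivAt_koebeH {z : ℂ} (hz : ‖z‖ < 1) :
    HasDerivAt koebeH ((1 + z) / (1 - z) ^ 4) z := by
  have h0 := one_sub_ne_zero hz
  have h1 := (((hasDerivAt_id z).sub (((hasDerivAt_id z).pow 2).const_mul (1 / 2))).add
    (((hasDerivAt_id z).pow 3).const_mul (1 / 6))).div
    (((hasDerivAt_id z).const_sub 1).pow 3) (pow_ne_zero 3 h0)
  refine h1.congr_deriv ?_
  simp
  field_simp
  ring

lemma hasDerivAt_koebeG {z : ℂ} (hz : ‖z‖ < 1) :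
    HasDerivAt koebeG (z * (1 + z) / (1 - z) ^ 4) z := by
  have h0 := one_sub_ne_zero hz
  have h1 := ((((hasDerivAt_id z).pow 2).const_mul (1 / 2)).add
    (((hasDerivAt_id z).pow 3).const_mul (1 / 6))).div
    (((hasDerivAt_id z).const_sub 1).pow 3) (pow_ne_zero 3 h0)
  refine h1.congr_deriv ?_
  simp
  field_simp
  ring

/-- The Cayley transform of the disk onto the right half-plane. -/
noncomputable def cayley (z : ℂ) : ℂ := (1 + z) / (1 - z)

lemma cayley_re_pos {z : ℂ} (hz : ‖z‖ < 1) : 0 < (cayley z).re := by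
  have h0 := normSq_pos.2 (one_sub_ne_zero hz)
  have h1 : z.re ^ 2 + z.im ^ 2 < 1 := by
    have : normSq z < 1 := by rw [normSq_eq_norm_sq]; nlinarith [norm_nonneg z]
    rw [normSq_apply] at this
    linarith
  rw [cayley, div_re, ← add_div]
  refine div_pos ?_ h0
  simp
  nlinarith

lemma cayley_injOn {z w : ℂ} (hz : ‖z‖ < 1) (hw : ‖w‖ < 1) (h : cayley z = cayley w) : z = w := by
  rw [cayley, cayley, div_eq_div_iff (one_sub_ne_zero hz) (one_sub_ne_zero hw)] at h
  linear_combination h / 2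

lemma koebeH_eq {z : ℂ} (hz : ‖z‖ < 1) :
    koebeH z = (cayley z ^ 3 - 1) / 12 + (cayley z ^ 2 - 1) / 8 := by
  have h0 := one_sub_ne_zero hz
  rw [koebeH, cayley]
  field_simp
  ring

lemma koebeG_eq {z : ℂ} (hz : ‖z‖ < 1) :
    koebeG z = (cayley z ^ 3 - 1) / 12 - (cayley z ^ 2 - 1) / 8 := by
  have h0 := one_sub_ne_zero hz
  rw [koebeG, cayley]
  field_simp
  ring

lemma harmonicKoebe_re {z : ℂ} (hz : ‖z‖ < 1) :
    (harmonicKoebe z).re =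
      ((cayley z).re ^ 3 - 3 * (cayley z).re * (cayley z).im ^ 2 - 1) / 6 := by
  have h1 : harmonicKoebe z = koebeH z + conj (koebeG z) := rfl
  have h2 : koebeH z + koebeG z = (cayley z ^ 3 - 1) / 6 := by
    rw [koebeH_eq hz, koebeG_eq hz]; ring
  rw [h1, add_re, conj_re, ← add_re, h2]
  simp [pow_succ]
  ring

lemma harmonicKoebe_im {z : ℂ} (hz : ‖z‖ < 1) :
    (harmonicKoebe z).im = (cayley z).re * (cayley z).im / 2 := by
  have h1 : harmonicKoebe z = koebeH z + conj (koebeG z) := rfl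
  have h2 : koebeH z - koebeG z = (cayley z ^ 2 - 1) / 4 := by
    rw [koebeH_eq hz, koebeG_eq hz]; ring
  rw [h1, add_im, conj_im, ← sub_eq_add_neg, ← sub_im, h2]
  simp [pow_succ]
  ring

lemma harmonicKoebe_injOn {z w : ℂ} (hz : ‖z‖ < 1) (hw : ‖w‖ < 1)
    (h : harmonicKoebe z = harmonicKoebe w) : z = w := by
  refine cayley_injOn hz hw ?_
  have hx := cayley_re_pos hz
  have hu := cayley_re_pos hw
  have h1 := congrArg Complex.re h
  have h2 := congrArg Complex.im h
  rw [harmonicKoebe_re hz, harmonicKoebe_re hw] at h1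
  rw [harmonicKoebe_im hz, harmonicKoebe_im hw] at h2
  set x := (cayley z).re
  set y := (cayley z).im
  set u := (cayley w).re
  set v := (cayley w).im
  have h3 : x * y = u * v := by linarith
  have h4 : x ^ 3 - 3 * x * y ^ 2 = u ^ 3 - 3 * u * v ^ 2 := by linarith
  -- Elimination of `y` and `v`: after multiplication by `x u` they enter only through the common
  -- product `x y = u v`.
  have h5 : (x - u) * (x * u * (x ^ 2 + x * u + u ^ 2) + 3 * (x * y) ^ 2) = 0 := by
    linear_combination x * u * h4 + 3 * x * (x * y + u * v) * h3
  have h6 : x * u * (x ^ 2 + x * u + u ^ 2) + 3 * (x * y) ^ 2 ≠ 0 := by positivity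
  have h7 : x = u := sub_eq_zero.1 ((mul_eq_zero.1 h5).resolve_right h6)
  have h8 : y = v := by
    rw [h7] at h3
    exact mul_left_cancel₀ hu.ne' h3
  exact Complex.ext h7 h8

/-- The value `-1/6` would force `ζ = 0`, a boundary point of the right half-plane. -/
lemma harmonicKoebe_ne {z : ℂ} (hz : ‖z‖ < 1) : harmonicKoebe z ≠ -(1 / 6) := by
  intro h
  have hx := cayley_re_pos hz
  have h1 := congrArg Complex.re h
  have h2 := congrArg Complex.im h
  rw [harmonicKoebe_re hz] at h1
  rw [harmonicKoebe_im hz] at h2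
  norm_num at h1 h2
  have h3 : (cayley z).im = 0 := h2.resolve_left hx.ne'
  rw [h3] at h1
  have := pow_pos hx 3
  norm_num at h1
  linarith

lemma harmonicKoebe_ofReal {t : ℝ} (ht : |t| < 1) :
    harmonicKoebe t = ((1 / 6 * (((1 + t) / (1 - t)) ^ 3 - 1) : ℝ) : ℂ) := by
  have hn : ‖(t : ℂ)‖ < 1 := by rwa [norm_real]
  have h1 : cayley t = (((1 + t) / (1 - t) : ℝ) : ℂ) := by simp [cayley]
  refine Complex.ext ?_ ?_
  · rw [harmonicKoebe_re hn, h1, ofReal_re, ofReal_im, ofReal_re]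
    ring
  · rw [harmonicKoebe_im hn, h1, ofReal_im, ofReal_im]
    simp

lemma norm_exp_ofReal_mul_I_mul (α : ℝ) (z : ℂ) : ‖exp (α * I) * z‖ = ‖z‖ := by
  rw [norm_mul, norm_exp_ofReal_mul_I, one_mul]

lemma exp_neg_mul_exp (α : ℝ) : exp (-(α * I)) * exp (α * I) = 1 := by
  rw [← exp_add, neg_add_cancel, exp_zero]

lemma hasDerivAt_comp_rotation {F : ℂ → ℂ} {F' c : ℂ} {z : ℂ} (a : ℂ)
    (h : HasDerivAt F F' (a * z)) : HasDerivAt (fun w => c * F (a * w)) (c * F' * a) z := by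
  have h1 : HasDerivAt (fun w : ℂ => a * w) a z := by
    simpa using (hasDerivAt_id z).const_mul a
  exact ((h.comp z h1).const_mul c).congr_deriv (by ring)

lemma analyticOnNhd_of_hasDerivAt {F F' : ℂ → ℂ} (h : ∀ z, ‖z‖ < 1 → HasDerivAt F (F' z) z) :
    AnalyticOnNhd ℂ F unitDisk :=
  DifferentiableOn.analyticOnNhd
    (fun z hz => (h z (mem_ball_zero_iff.1 hz)).differentiableAt.differentiableWithinAt)
    isOpen_ball

theorem rotatedKoebe_mem (α : ℝ) : rotatedKoebe α ∈ classSH0S := by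
  set a := exp (α * I) with ha
  set b := exp (-(α * I)) with hb
  have hba : b * a = 1 := exp_neg_mul_exp α
  have han : ‖a‖ = 1 := norm_exp_ofReal_mul_I α
  have hbn : ‖b‖ = 1 := by
    have := congrArg norm hba
    rwa [norm_mul, han, mul_one, norm_one] at this
  have hca : conj a = b := by
    rw [ha, hb, ← exp_conj]; simp
  have hmn : ∀ z : ℂ, ‖a * z‖ = ‖z‖ := fun z => by rw [norm_mul, han, one_mul]
  have hH : ∀ z : ℂ, ‖z‖ < 1 → HasDerivAt (fun w => b * koebeH (a * w))
      ((1 + a * z) / (1 - a * z) ^ 4) z := fun z hz =>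
    (hasDerivAt_comp_rotation a (hasDerivAt_koebeH (by rwa [hmn]))).congr_deriv (by
      linear_combination ((1 + a * z) / (1 - a * z) ^ 4) * hba)
  have hG : ∀ z : ℂ, ‖z‖ < 1 → HasDerivAt (fun w => a * koebeG (a * w))
      (a ^ 2 * (a * z * (1 + a * z) / (1 - a * z) ^ 4)) z := fun z hz =>
    (hasDerivAt_comp_rotation a (hasDerivAt_koebeG (by rwa [hmn]))).congr_deriv (by ring)
  have h10 : ∀ z : ℂ, ‖z‖ < 1 → 1 + a * z ≠ 0 := fun z hz => by
    have := one_sub_ne_zero (z := -(a * z)) (by rwa [norm_neg, hmn])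
    rwa [sub_neg_eq_add] at this
  have h20 : ∀ z : ℂ, ‖z‖ < 1 → 1 - a * z ≠ 0 := fun z hz =>
    one_sub_ne_zero (by rwa [hmn])
  -- The factor of the co-analytic part is `a = conj b`, because that part is conjugated. With `θ =
  -- π - 2α` one gets `e^{iθ} a = -b`, so `h + e^{iθ} g` is the rotation of `koebeH - koebeG = (ζ² -
  -- 1)/4`, the classical Koebe function `z/(1 - z)²`.
  refine ⟨fun z => b * koebeH (a * z), fun z => a * koebeG (a * z), ?_, ?_, Real.pi - 2 * α, ?_⟩
  · refine ⟨⟨analyticOnNhd_of_hasDerivAt hH, analyticOnNhd_of_hasDerivAt hG, by simp [koebeH],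
      by simp [koebeG], ?_, ?_⟩, ?_, ?_⟩
    · rw [(hH 0 (by simp)).deriv]; simp
    · intro z _
      simp only [rotatedKoebe, harmonicKoebe]
      rw [map_mul, hca, ← mul_add]
      rfl
    · intro z hz
      have hz := mem_ball_zero_iff.1 hz
      rw [jacobian, (hH z hz).deriv, (hG z hz).deriv]
      have h1 : ‖a ^ 2 * (a * z * (1 + a * z) / (1 - a * z) ^ 4)‖ =
          ‖z‖ * ‖(1 + a * z) / (1 - a * z) ^ 4‖ := by
        rw [mul_div_assoc, norm_mul, norm_mul, norm_pow, han, hmn]; ring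
      have h2 : 0 < ‖(1 + a * z) / (1 - a * z) ^ 4‖ :=
        norm_pos_iff.2 (div_ne_zero (h10 z hz) (pow_ne_zero 4 (h20 z hz)))
      rw [h1]
      have h3 : 0 < (1 - ‖z‖ ^ 2) := by nlinarith [norm_nonneg z]
      nlinarith [mul_pos h3 (pow_pos h2 2)]
    · intro z hz w hw h
      have hz := mem_ball_zero_iff.1 hz
      have hw := mem_ball_zero_iff.1 hw
      have h1 := mul_left_cancel₀ (exp_ne_zero _) h
      have h2 := harmonicKoebe_injOn (by rwa [norm_exp_ofReal_mul_I_mul]) (by rwa [norm_exp_ofReal_mul_I_mul]) h1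
      exact mul_left_cancel₀ (exp_ne_zero _) h2
  · rw [(hG 0 (by simp)).deriv]; simp
  · have hexp : exp ((Real.pi - 2 * α : ℝ) * I) = -(b * b) := by
      rw [hb, ← exp_add]
      push_cast
      rw [sub_mul, sub_eq_add_neg, exp_add, exp_pi_mul_I, neg_one_mul]
      congr 2
      ring
    have hφ : ∀ z : ℂ, ‖z‖ < 1 → b * koebeH (a * z) + -(b * b) * (a * koebeG (a * z)) =
        b * ((cayley (a * z) ^ 2 - 1) / 4) := fun z hz => by
      rw [koebeH_eq (by rwa [hmn]), koebeG_eq (by rwa [hmn])]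
      linear_combination (-b * ((cayley (a * z) ^ 3 - 1) / 12 - (cayley (a * z) ^ 2 - 1) / 8)) * hba
    have hd : ∀ z : ℂ, ‖z‖ < 1 → HasDerivAt
        (fun w => b * koebeH (a * w) + -(b * b) * (a * koebeG (a * w)))
        ((1 + a * z) / (1 - a * z) ^ 3) z := fun z hz => by
      refine ((hH z hz).add ((hG z hz).const_mul (-(b * b)))).congr_deriv ?_
      have := h20 z hz
      field_simp
      linear_combination (-(1 + a * z) * a * z * (b * a + 1)) * hba
    rw [hexp]
    refine ⟨_, fun _ => 0, ⟨⟨analyticOnNhd_of_hasDerivAt hd, analyticOnNhd_const, by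
      simp [koebeH, koebeG], rfl, ?_, fun z _ => by simp⟩, ?_, ?_⟩, fun _ _ => rfl⟩
    · rw [(hd 0 (by simp)).deriv]; simp
    · intro z hz
      have hz := mem_ball_zero_iff.1 hz
      rw [jacobian, (hd z hz).deriv]
      have h2 : 0 < ‖(1 + a * z) / (1 - a * z) ^ 3‖ :=
        norm_pos_iff.2 (div_ne_zero (h10 z hz) (pow_ne_zero 3 (h20 z hz)))
      simp only [deriv_const', norm_zero]
      have := pow_pos h2 2
      linarith
    · intro z hz w hw h
      have hz := mem_ball_zero_iff.1 hz
      have hw := mem_ball_zero_iff.1 hw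
      simp only at h
      rw [hφ z hz, hφ w hw] at h
      have h1 := mul_left_cancel₀ (exp_ne_zero _) h
      have h2 : cayley (a * z) ^ 2 = cayley (a * w) ^ 2 := by linear_combination 4 * h1
      have hz' : ‖a * z‖ < 1 := by rwa [hmn]
      have hw' : ‖a * w‖ < 1 := by rwa [hmn]
      have h3 : cayley (a * z) = cayley (a * w) := by
        rcases sq_eq_sq_iff_eq_or_eq_neg.1 h2 with h3 | h3
        · exact h3
        · have h4 := cayley_re_pos hz'
          have h5 := cayley_re_pos hw'
          rw [h3, neg_re] at h4
          linarith
      exact mul_left_cancel₀ (exp_ne_zero _) (cayley_injOn hz' hw' h3)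

lemma norm_rotatedKoebe (α : ℝ) (z : ℂ) :
    ‖rotatedKoebe α z‖ = ‖harmonicKoebe (exp (α * I) * z)‖ := by
  rw [rotatedKoebe, norm_mul, ← neg_mul, ← ofReal_neg, norm_exp_ofReal_mul_I, one_mul]

theorem norm_rotatedKoebe_lower (α : ℝ) {r : ℝ} (hr : 0 ≤ r) (hr1 : r < 1) :
    ‖rotatedKoebe α (-(r * exp (-(α * I))))‖ = (1 / 6) * (1 - ((1 - r) / (1 + r)) ^ 3) := by
  have h1 : exp (α * I) * -(r * exp (-(α * I))) = ((-r : ℝ) : ℂ) := by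
    push_cast; linear_combination (-r : ℂ) * exp_neg_mul_exp α
  have h2 : ((1 - r) / (1 + r)) ^ 3 ≤ 1 :=
    pow_le_one₀ (div_nonneg (by linarith) (by linarith))
      ((div_le_one (by linarith)).2 (by linarith))
  rw [norm_rotatedKoebe, h1, harmonicKoebe_ofReal (by rw [abs_neg, abs_of_nonneg hr]; exact hr1),
    norm_real, sub_neg_eq_add, ← sub_eq_add_neg, Real.norm_of_nonpos (by linarith)]
  ring

theorem norm_rotatedKoebe_upper (α : ℝ) {r : ℝ} (hr : 0 ≤ r) (hr1 : r < 1) :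
    ‖rotatedKoebe α (r * exp (-(α * I)))‖ = (1 / 6) * (((1 + r) / (1 - r)) ^ 3 - 1) := by
  have h1 : exp (α * I) * (r * exp (-(α * I))) = (r : ℂ) := by
    linear_combination (r : ℂ) * exp_neg_mul_exp α
  have h2 : 1 ≤ ((1 + r) / (1 - r)) ^ 3 :=
    one_le_pow₀ ((one_le_div (by linarith)).2 (by linarith))
  rw [norm_rotatedKoebe, h1, harmonicKoebe_ofReal (by rw [abs_of_nonneg hr]; exact hr1),
    norm_real, Real.norm_of_nonneg (by linarith)]

theorem exists_omitted (α : ℝ) : ∃ w : ℂ, ‖w‖ = 1 / 6 ∧ w ∉ rotatedKoebe α '' unitDisk := by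
  refine ⟨exp (-(α * I)) * -(1 / 6), ?_, ?_⟩
  · rw [norm_mul, ← neg_mul, ← ofReal_neg, norm_exp_ofReal_mul_I]
    norm_num
  · rintro ⟨z, hz, h⟩
    have hz := mem_ball_zero_iff.1 hz
    exact harmonicKoebe_ne (by rwa [norm_exp_ofReal_mul_I_mul]) (mul_left_cancel₀ (exp_ne_zero _) h)

end HarmonicUnivalent

theorem mainTheorem3 :
    (∀ f ∈ HarmonicUnivalent.classSH0S,
      (∀ z : ℂ, ‖z‖ < 1 →
        (1 / 6 : ℝ) * (1 - ((1 - ‖z‖) / (1 + ‖z‖)) ^ 3) ≤ ‖f z‖ ∧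
        ‖f z‖ ≤ (1 / 6 : ℝ) * (((1 + ‖z‖) / (1 - ‖z‖)) ^ 3 - 1)) ∧
      Metric.ball (0 : ℂ) (1 / 6) ⊆ f '' HarmonicUnivalent.unitDisk) ∧
    -- sharpness: the harmonic Koebe function (`α = 0`) and its rotations are extremal
    (∀ α : ℝ,
      HarmonicUnivalent.rotatedKoebe α ∈ HarmonicUnivalent.classSH0S ∧
      (∀ r : ℝ, 0 ≤ r → r < 1 →
        ‖HarmonicUnivalent.rotatedKoebe α (-(r * Complex.exp (-(α * Complex.I))))‖ =
          (1 / 6 : ℝ) * (1 - ((1 - r) / (1 + r)) ^ 3) ∧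
        ‖HarmonicUnivalent.rotatedKoebe α (r * Complex.exp (-(α * Complex.I)))‖ =
          (1 / 6 : ℝ) * (((1 + r) / (1 - r)) ^ 3 - 1)) ∧
      ∃ w : ℂ, ‖w‖ = 1 / 6 ∧
        w ∉ HarmonicUnivalent.rotatedKoebe α '' HarmonicUnivalent.unitDisk) := by
  refine ⟨fun f hf => ⟨fun z hz => ⟨HarmonicUnivalent.lower_growth hf hz,
    HarmonicUnivalent.upper_growth hf hz⟩, HarmonicUnivalent.ball_subset_image hf⟩, fun α =>
    ⟨HarmonicUnivalent.rotatedKoebe_mem α, fun r hr hr1 =>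
      ⟨HarmonicUnivalent.norm_rotatedKoebe_lower α hr hr1,
        HarmonicUnivalent.norm_rotatedKoebe_upper α hr hr1⟩, HarmonicUnivalent.exists_omitted α⟩⟩
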